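/- **Setting.** Let $\mathcal X$ be a measurable space, $\mathcal Y$ a finite label set, $p_{XY}$ a probability distribution on $\mathcal X\times\mathcal Y$ with marginals $p_X,P_Y$, and $\mathcal U$ a representation space with reference measure $du$ (Lebesgue measure if $\mathcal U$ is continuous, counting measure if it is discrete) and $\mathrm{Vol}(\mathcal U)=\int_{\mathcal U}du$. Assume $P_Y(y_{\min}):=\min_{y}P_Y(y)>0$ and $1\le \mathrm{Vol}(\mathcal U)<\infty$. An encoder $q_{U|X}$ is a family of conditional densities (pdf or pmf) $q_{U|X}(\cdot|x)$ with respect to $du$; a decoder $Q_{\hat Y|U}$ assigns to each $u\in\mathcal U$ a pmf on $\mathcal Y$. Put $\ell(x,y)=\mathbb E_{q_{U|X}}[-\log Q_{\hat Y|U}(y|U)\mid X=x]$ and, for $\mathcal S_n=\{(x_i,y_i)\}_{i=1}^n$, $$\mathcal E_{\rm gap}(q_{U|X},Q_{\hat Y|U},\mathcal S_n)=\Big|\frac1n\sum_{i=1}^n\ell(x_i,y_i)-\mathbb E_{p_{XY}}[\ell(X,Y)]\Big| .$$ Mutual information is $\mathcal I(p_X;q_{U|X})=\mathbb E_{p_X}\big[\mathcal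 D(q_{U|X}(\cdot|X)\,\|\,q_U)\big]\in[0,\infty]$, where $q_U(u)=\mathbb E_{p_X}[q_{U|X}(u|X)]$ and $\mathcal D$ is the Kullback–Leibler divergence. For each natural number $K$ in a given set $\mathcal N$ (all $K$ for which a quantization has been chosen) and each $y\in\mathcal Y$, let $\mathcal K^{(y)}_1,\dots,\mathcal K^{(y)}_K$ be a measurable partition of $\mathcal X$ with centroids $x^{(1,y)},\dots,x^{(K,y)}\in\mathcal X$, and set $$\epsilon(K)=\sup_{k,\;y,\;x\in\mathcal K_k^{(y)}}\big|\ell(x,y)-\ell(x^{(k,y)},y)\big|,\qquad r(K)=\frac1{\min_{k,y}p_X(\mathcal K_k^{(y)})},$$ $$q_U^D(u)=\sum_{k=1}^K\sum_{y}q_{U|X}(u|x^{(k,y)})\,p_{XY}(\mathcal K_k^{(y)}\times\{y\}),\qquad Q^D_{Y|U}(y|u)=\frac{\sum_{k=1}^K q_{U|X}(u|x^{(k,y)})\,p_{XY}(\mathcal K_k^{(y)}\times\{y\})}{q_U^D(u)},$$ $$\mathcal D_{\rm HL}(K)=\mathcal D_{\rm HL}\big(Q^D_{Y|U}\|Q_{\hat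 Y|U}|q^D_U\big)=\sqrt{\tfrac12\,\mathbb E_{q_U^D}\Big[\sum_{y}\Big(\sqrt{Q_{\hat Y|U}(y|U)}-\sqrt{Q^D_{Y|U}(y|U)}\Big)^2\Big]} .$$ (Here $1/0=\infty$, $0\cdot\infty=0$.) **Theorem (information-theoretic bound).** Let $\delta\in(0,1)$. There is a sequence $R_n\ge0$ with $R_n=\mathcal O(\log n/n)$, not depending on the encoder, the decoder or the partitions, such that for every encoder–decoder pair $(q_{U|X},Q_{\hat Y|U})$ with $Q_{\hat Y|U}(y_{\min}|u_{\min}):=\inf_{y,u}Q_{\hat Y|U}(y|u)\ge\eta$ for some $\eta>0$, every choice of quantizations as above and every $n\ge1$, with probability at least $1-\delta$ over $n$ i.i.d. samples $\mathcal S_n$ from $p_{XY}$, $$\mathcal E_{\rm gap}(q_{U|X},Q_{\hat Y|U},\mathcal S_n)\le\inf_{K\in\mathcal N}\left\{2\epsilon(K)+A_\delta\sqrt{\mathcal I(p_X;q_{U|X})}\,\frac{\log n}{\sqrt n}\,r(K)+\frac{D_\delta\,\mathcal D_{\rm HL}(K)+C_\delta}{\sqrt n}\right\}+R_n ,$$ where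 $B_\delta=1+\sqrt{\log\frac{|\mathcal Y|+4}{\delta}}$, $A_\delta=\sqrt2\,B_\delta$, $C_\delta=2\,\mathrm{Vol}(\mathcal U)e^{-1}+B_\delta\sqrt{|\mathcal Y|}\log\frac{\mathrm{Vol}(\mathcal U)}{P_Y(y_{\min})}$ and $D_\delta=Q_{\hat Y|U}(y_{\min}|u_{\min})^{-1/4}\sqrt{8\frac{|\mathcal Y|+4}{\delta}}$. -/

import Mathlib

open MeasureTheory InformationTheory Filter Asymptotics
open scoped ENNReal NNReal

noncomputable section

namespace CrossEntropyGap

variable {X Y U : Type*} [MeasurableSpace X] [MeasurableSpace Y] [Fintype Y] [MeasurableSpace U]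

/-- A randomized encoder `q_{U|X}`, given by its conditional densities `u ↦ q(u|x)` with respect to
the reference measure `vol` on `U`: conditional pdf's when `vol` is Lebesgue measure on a region,
conditional pmf's when `vol` is counting measure. -/
structure Encoder (X : Type*) {U : Type*} [MeasurableSpace X] [MeasurableSpace U]
    (vol : Measure U) where
  dens : X → U → ℝ≥0
  measurable_dens : Measurable (Function.uncurry dens)
  lintegral_dens : ∀ x, ∫⁻ u, dens x u ∂vol = 1

/-- A soft decoder `Q_{Ŷ|U}`: for each `u`, a probability mass function `y ↦ Q(y|u)` on `Y`. -/
structure Decoder (U Y : Type*) [MeasurableSpace U] [Fintype Y] where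
  prob : U → Y → ℝ
  measurable_prob : ∀ y, Measurable fun u => prob u y
  prob_nonneg : ∀ u y, 0 ≤ prob u y
  sum_prob : ∀ u, ∑ y, prob u y = 1

/-- For each label `y`, a partition of `X` into `K` measurable cells `cell k y`, together with
their centroids `center k y`. -/
structure Quantization (X Y : Type*) [MeasurableSpace X] (K : ℕ) where
  cell : Fin K → Y → Set X
  center : Fin K → Y → X
  measurableSet_cell : ∀ k y, MeasurableSet (cell k y)
  iUnion_cell : ∀ y, ⋃ k, cell k y = Set.univ
  disjoint_cell : ∀ y, Pairwise fun i j => Disjoint (cell i y) (cell j y)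

variable {vol : Measure U}

/-- The conditional law `q_{U|X}(· | x)` of the representation. -/
def Encoder.law (q : Encoder X vol) (x : X) : Measure U :=
  vol.withDensity fun u => (q.dens x u : ℝ≥0∞)

/-- The law `q_U` of the representation when the input has law `μ`; its density is
`u ↦ ∫ q(u|x) dμ(x)`. -/
def Encoder.marginal (q : Encoder X vol) (μ : Measure X) : Measure U :=
  vol.withDensity fun u => ∫⁻ x, (q.dens x u : ℝ≥0∞) ∂μ

/-- The mutual information `I(μ; q_{U|X}) = D(q_{U|X} ‖ q_U | μ)`. -/
def mutualInfo (μ : Measure X) (q : Encoder X vol) : ℝ≥0∞ :=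
  ∫⁻ x, klDiv (q.law x) (q.marginal μ) ∂μ

/-- The cross-entropy loss `ℓ(x, y) = E[-log Q(y|U) | X = x]`. -/
def loss (q : Encoder X vol) (Q : Decoder U Y) (x : X) (y : Y) : ℝ :=
  ∫ u, -Real.log (Q.prob u y) ∂(q.law x)

/-- The expected risk. -/
def risk (P : Measure (X × Y)) (q : Encoder X vol) (Q : Decoder U Y) : ℝ :=
  ∫ z, loss q Q z.1 z.2 ∂P

/-- The testing risk on the data set `S`. -/
def empRisk (q : Encoder X vol) (Q : Decoder U Y) {n : ℕ} (S : Fin n → X × Y) : ℝ :=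
  (1 / (n : ℝ)) * ∑ i, loss q Q (S i).1 (S i).2

/-- The error gap. -/
def gap (P : Measure (X × Y)) (q : Encoder X vol) (Q : Decoder U Y) {n : ℕ}
    (S : Fin n → X × Y) : ℝ :=
  |empRisk q Q S - risk P q Q|

/-- The smallest class probability `P_Y(y_min)`. -/
def minClassProb (P : Measure (X × Y)) : ℝ :=
  ⨅ y, (P.map Prod.snd).real {y}

/-- The smallest decoder probability `Q(y_min|u_min) = inf_{y,u} Q(y|u)`. -/
def Decoder.minProb (Q : Decoder U Y) : ℝ :=
  ⨅ z : U × Y, Q.prob z.1 z.2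

/-- `ε(K)`: the largest variation of the loss between a point of a cell and the centroid. -/
def epsilonK (q : Encoder X vol) (Q : Decoder U Y) {K : ℕ} (c : Quantization X Y K) : ℝ :=
  sSup {a | ∃ k y, ∃ x ∈ c.cell k y, a = |loss q Q x y - loss q Q (c.center k y) y|}

/-- `r(K)`: the inverse of the smallest probability, under `p_X`, of a cell. -/
def rK (P : Measure (X × Y)) {K : ℕ} (c : Quantization X Y K) : ℝ≥0∞ :=
  (⨅ k, ⨅ y, P.map Prod.fst (c.cell k y))⁻¹

/-- The density `(u, y) ↦ ∑_k q(u|x^{(k,y)}) p_{XY}(cell k y × {y})` of `(U, Y)` under the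
quantized testing distribution. -/
def jointD (P : Measure (X × Y)) (q : Encoder X vol) {K : ℕ} (c : Quantization X Y K)
    (u : U) (y : Y) : ℝ :=
  ∑ k, (q.dens (c.center k y) u : ℝ) * P.real (c.cell k y ×ˢ {y})

/-- The density `q_U^D`. -/
def densD (P : Measure (X × Y)) (q : Encoder X vol) {K : ℕ} (c : Quantization X Y K)
    (u : U) : ℝ :=
  ∑ y, jointD P q c u y

/-- The induced decoder `Q^D_{Y|U}`. -/
def decoderD (P : Measure (X × Y)) (q : Encoder X vol) {K : ℕ} (c : Quantization X Y K)
    (u : U) (y : Y) : ℝ :=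
  jointD P q c u y / densD P q c u

/-- The conditional Hellinger distance between `Q^D_{Y|U}` and `Q_{Ŷ|U}` given `q_U^D`. -/
def hellinger (P : Measure (X × Y)) (q : Encoder X vol) (Q : Decoder U Y) {K : ℕ}
    (c : Quantization X Y K) : ℝ :=
  √(1 / 2 * ∫ u, ∑ y, (√(Q.prob u y) - √(decoderD P q c u y)) ^ 2
    ∂(vol.withDensity fun u => ENNReal.ofReal (densD P q c u)))

/-- The constant `B_δ`, with `m` the number of classes. -/
def constB (m : ℕ) (δ : ℝ) : ℝ :=
  1 + √(Real.log (((m : ℝ) + 4) / δ))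

/-- The constant `A_δ`. -/
def constA (m : ℕ) (δ : ℝ) : ℝ :=
  √2 * constB m δ

/-- The constant `C_δ`, with `v = Vol(U)` and `p = P_Y(y_min)`. -/
def constC (m : ℕ) (δ v p : ℝ) : ℝ :=
  2 * v * Real.exp (-1) + constB m δ * √(m : ℝ) * Real.log (v / p)

/-- The constant `D_δ`, with `s = Q(y_min|u_min)`. -/
def constD (m : ℕ) (δ s : ℝ) : ℝ :=
  s ^ (-(1 / 4 : ℝ)) * √(8 * (((m : ℝ) + 4) / δ))

/-- The four explicit terms of the bound, for one quantization. The value is `∞` when the mutual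
information is infinite. -/
def mainBound (P : Measure (X × Y)) (q : Encoder X vol) (Q : Decoder U Y) (δ : ℝ) (n : ℕ) {K : ℕ}
    (c : Quantization X Y K) : ℝ≥0∞ :=
  ENNReal.ofReal (2 * epsilonK q Q c)
    + ENNReal.ofReal (constA (Fintype.card Y) δ)
        * mutualInfo (P.map Prod.fst) q ^ (1 / 2 : ℝ)
        * ENNReal.ofReal (Real.log n / √(n : ℝ)) * rK P c
    + ENNReal.ofReal
        ((constD (Fintype.card Y) δ Q.minProb * hellinger P q Q c
          + constC (Fintype.card Y) δ (vol.real Set.univ) (minClassProb P)) / √(n : ℝ))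

end CrossEntropyGap

end

/-! Replace each labelled input by its cell and split the loss as `cellInfo` + `cellExcess` + error,
where `cellInfo` averages `-log Q^D(y|U)` over the representation of the centroid and the error is
at most `ε(K)` in absolute value. The error costs `2 ε(K)`; the other two terms are controlled by
separate concentration inequalities.

For `cellInfo` the point is that no lower bound on `Q^D` is needed. Given `U = u`, the label has law
`Q^D(·|u)`, so Jensen's inequality reduces moments of `cellInfo` to moments of `-log p` under a
probability mass function `p` on `m = |𝒴|` points. The exponential moment is at most `m`, and the
second moment about a suitable fixed centre is at most `m/2 * log m ^ 2`
(`exists_second_moment_le`). Bernstein's inequality (`pi_abs_mean_sub_gt_le`) then gives a deviation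
`C_δ/√n + O(1/n)`. For `cellExcess`, a pointwise comparison of squared log-ratios with squared
differences of square roots bounds the second moment by the Hellinger distance
(`integral_cellExcess_sq_le`), and Chebyshev's inequality gives `D_δ 𝒟_HL/√n`.

Thus `C_δ` already pays for the whole fluctuation of `cellInfo`: the mutual information term is only
used through its nonnegativity. The infimum over `K` costs nothing, because the bounds do not depend
on the sample and so the failure events are nested (`measure_iInf_lt_le`). -/

namespace CrossEntropyGap

/-! ### Second moments of the information content -/

/-- The tangent to the concave function `w ↦ w * (-2 * log w - c)` at `w₀` lies above it. -/
lemma sqrt_mul_neg_log_sub_le {p : ℝ} (hp : 0 ≤ p) {w₀ : ℝ} (hw₀ : 0 < w₀) (c : ℝ) :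
    √p * (-Real.log p - c) ≤ 2 * w₀ + √p * (-2 * Real.log w₀ - c - 2) := by
  rcases hp.eq_or_lt with rfl | hp
  · simpa using hw₀.le
  have hw : 0 < √p := Real.sqrt_pos.2 hp
  have h1 : Real.log p = 2 * Real.log (√p) := by rw [Real.log_sqrt hp.le]; ring
  have h2 : Real.log w₀ - Real.log (√p) ≤ w₀ / √p - 1 := by
    rw [← Real.log_div hw₀.ne' hw.ne']
    exact Real.log_le_sub_one_of_pos (by positivity)
  have h3 : √p * (Real.log w₀ - Real.log (√p)) ≤ w₀ - √p := by
    calc _ ≤ √p * (w₀ / √p - 1) := by gcongr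
      _ = _ := by field_simp
  rw [h1]
  linarith

lemma mul_sq_eq_sqrt_mul_sq {p : ℝ} (hp : 0 ≤ p) (a : ℝ) : p * a ^ 2 = (√p * a) ^ 2 := by
  rw [mul_pow, Real.sq_sqrt hp]

/-- With `c = 0` the tangent at `√p = e⁻¹` is horizontal, so it gives the maximum of `√p * (-log
p)`. -/
lemma mul_log_sq_le {p : ℝ} (hp : 0 ≤ p) (hp1 : p ≤ 1) :
    p * (-Real.log p) ^ 2 ≤ 4 * Real.exp (-1) ^ 2 := by
  have h := sqrt_mul_neg_log_sub_le hp (Real.exp_pos (-1)) 0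
  rw [Real.log_exp] at h
  have h0 : 0 ≤ √p * (-Real.log p) :=
    mul_nonneg (Real.sqrt_nonneg _) (neg_nonneg.2 (Real.log_nonpos hp hp1))
  rw [mul_sq_eq_sqrt_mul_sq hp]
  calc _ ≤ (2 * Real.exp (-1)) ^ 2 := pow_le_pow_left₀ h0 (by linarith) 2
    _ = _ := by ring

/-- The centre `1 / 4` is needed: about `0` the second moment exceeds `log 2 ^ 2`, for instance at
`p = 0.08`. -/
lemma binary_second_moment_le_of_le {p q : ℝ} (hp : 0 ≤ p) (hpq : p ≤ q) (h1 : p + q = 1) :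
    p * (-Real.log p - 1 / 4) ^ 2 + q * (-Real.log q - 1 / 4) ^ 2 ≤ Real.log 2 ^ 2 := by
  have hl1 := Real.log_two_gt_d9
  have hl2 := Real.log_two_lt_d9
  have hq : 1 / 2 ≤ q := by linarith
  have hp2 : p ≤ 1 / 2 := by linarith
  have hl : (0.4803 : ℝ) ≤ Real.log 2 ^ 2 := by nlinarith
  have hw0 := Real.sqrt_nonneg p
  have hw2 := Real.sq_sqrt hp
  have hpos : 0 ≤ √p * (-Real.log p - 1 / 4) := by
    rcases hp.eq_or_lt with rfl | hp'
    · simp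
    have : Real.log p ≤ Real.log (1 / 2) := Real.log_le_log hp' hp2
    rw [one_div, Real.log_inv] at this
    exact mul_nonneg hw0 (by linarith)
  have hlogq : p ≤ -Real.log q := by
    have := Real.log_le_sub_one_of_pos (show 0 < q by linarith)
    linarith
  have hlogq' : q * (-Real.log q) ≤ p := by
    have := Real.one_sub_inv_le_log_of_pos (show 0 < q by linarith)
    have h3 : q * (1 - q⁻¹) ≤ q * Real.log q := by gcongr
    rw [mul_sub, mul_inv_cancel₀ (by linarith)] at h3
    linarith
  rw [mul_sq_eq_sqrt_mul_sq hp]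
  -- On `[0, 1/16]`, `[1/16, 1/5]` and `[1/5, 1/2]` the term in `p` is bounded by the tangent at `√p
  -- = 1/4`, `√(1/8)` and `1/2` respectively. For `p ≤ 1/5`, `-log q` lies between `p` and `1/4`,
  -- which controls the term in `q`; on the last range that term needs its own tangent.
  rcases le_total p (1 / 5) with h5 | h5
  · have hlogq2 : -Real.log q ≤ 1 / 4 := by nlinarith
    have hqt : q * (-Real.log q - 1 / 4) ^ 2 ≤ (1 - p) * (1 / 4 - p) ^ 2 := by
      have : (-Real.log q - 1 / 4) ^ 2 ≤ (1 / 4 - p) ^ 2 := by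
        rw [← neg_sq]; gcongr <;> linarith
      have hq' : q = 1 - p := by linarith
      rw [← hq']
      gcongr
    rcases le_total p (1 / 16) with h16 | h16
    · have ht := sqrt_mul_neg_log_sub_le hp (show (0 : ℝ) < 1 / 4 by norm_num) (1 / 4)
      have hl4 : Real.log (1 / 4) = -2 * Real.log 2 := by
        rw [show (1 / 4 : ℝ) = (2 ^ 2)⁻¹ by norm_num, Real.log_inv, Real.log_pow]; push_cast; ring
      rw [hl4] at ht
      have hw : √p ≤ 1 / 4 := Real.sqrt_le_iff.2 ⟨by norm_num, by linarith⟩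
      have : √p * (-Real.log p - 1 / 4) ≤ 0.631 := by nlinarith
      have : (√p * (-Real.log p - 1 / 4)) ^ 2 ≤ 0.631 ^ 2 := by gcongr
      nlinarith
    · have ht := sqrt_mul_neg_log_sub_le hp (show (0 : ℝ) < √(1 / 8) by positivity) (1 / 4)
      have hl8 : Real.log (√(1 / 8)) = -(3 / 2) * Real.log 2 := by
        rw [Real.log_sqrt (by norm_num), show (1 / 8 : ℝ) = (2 ^ 3)⁻¹ by norm_num, Real.log_inv,
          Real.log_pow]; push_cast; ring
      rw [hl8] at ht
      have hw8 : √(1 / 8) ≤ 0.3536 := Real.sqrt_le_iff.2 ⟨by norm_num, by norm_num⟩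
      have hw : 1 / 4 ≤ √p := Real.le_sqrt_of_sq_le (by linarith)
      have : √p * (-Real.log p - 1 / 4) ≤ 0.6647 := by nlinarith
      have : (√p * (-Real.log p - 1 / 4)) ^ 2 ≤ 0.6647 ^ 2 := by gcongr
      have : (1 / 4 - p) ^ 2 ≤ (3 / 16) ^ 2 := by gcongr <;> linarith
      nlinarith
  · have ht := sqrt_mul_neg_log_sub_le hp (show (0 : ℝ) < 1 / 2 by norm_num) (1 / 4)
    have hl2' : Real.log (1 / 2) = - Real.log 2 := by rw [one_div, Real.log_inv]
    rw [hl2'] at ht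
    have hw : 0.447 ≤ √p := Real.le_sqrt_of_sq_le (by norm_num; linarith)
    have : √p * (-Real.log p - 1 / 4) ≤ 0.614 := by nlinarith
    have : (√p * (-Real.log p - 1 / 4)) ^ 2 ≤ 0.614 ^ 2 := by gcongr
    have hq0 : 0 ≤ q := by linarith
    have htq := sqrt_mul_neg_log_sub_le hq0 (show (0 : ℝ) < √(1 / 2) by positivity) (1 / 4)
    rw [Real.log_sqrt (by norm_num), hl2'] at htq
    have hv : √(1 / 2) ≤ √q := Real.sqrt_le_sqrt hq
    have hv2 : √(1 / 2) ≤ 0.7072 := Real.sqrt_le_iff.2 ⟨by norm_num, by norm_num⟩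
    have hv1 : √q ≤ 1 := Real.sqrt_le_iff.2 ⟨by norm_num, by linarith⟩
    have hup : √q * (-Real.log q - 1 / 4) ≤ 0.3134 := by nlinarith
    have hlo : -0.3134 ≤ √q * (-Real.log q - 1 / 4) := by
      have : -0.05 ≤ -Real.log q - 1 / 4 := by linarith
      nlinarith [Real.sqrt_nonneg q]
    have : q * (-Real.log q - 1 / 4) ^ 2 ≤ 0.3134 ^ 2 := by
      rw [mul_sq_eq_sqrt_mul_sq hq0]
      exact sq_le_sq' hlo hup
    nlinarith

/-- The information content of a probability mass function on `m` points has second moment at most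
`m / 2 * log m ^ 2` about a centre depending on `m` only. -/
lemma exists_second_moment_le (Y : Type*) [Fintype Y] [Nonempty Y] :
    ∃ c : ℝ, ∀ p : Y → ℝ, (∀ y, 0 ≤ p y) → ∑ y, p y = 1 →
      ∑ y, p y * (-Real.log (p y) - c) ^ 2
        ≤ (Fintype.card Y : ℝ) / 2 * Real.log (Fintype.card Y) ^ 2 := by
  classical
  have hcard : 1 ≤ Fintype.card Y := Fintype.card_pos
  rcases hcard.eq_or_lt with h1 | h2
  · obtain ⟨a, ha⟩ := Fintype.card_eq_one_iff.1 h1.symm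
    have huniv : (Finset.univ : Finset Y) = {a} := by ext y; simp [ha y]
    refine ⟨0, fun p _ hs => ?_⟩
    rw [huniv, Finset.sum_singleton] at *
    simp [hs, ← h1]
  rcases (Nat.succ_le_of_lt h2).eq_or_lt with h2 | h3
  · have h2 : Fintype.card Y = 2 := h2.symm
    obtain ⟨a, b, hab, huniv⟩ := Finset.card_eq_two.1 (Finset.card_univ.trans h2)
    refine ⟨1 / 4, fun p hp hs => ?_⟩
    rw [huniv, Finset.sum_pair hab] at *
    rw [h2]
    push_cast
    rw [div_self two_ne_zero, one_mul]
    rcases le_total (p a) (p b) with h | h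
    · exact binary_second_moment_le_of_le (hp a) h hs
    · rw [add_comm]
      exact binary_second_moment_le_of_le (hp b) h (by linarith)
  -- From three points on, bounding every summand by its maximum suffices, since `4 e⁻² < log 3 ^ 2
  -- / 2`.
  · refine ⟨0, fun p hp hs => ?_⟩
    have h3 : (3 : ℝ) ≤ Fintype.card Y := by exact_mod_cast h3
    have hlog3 : 1.08 ≤ Real.log 3 := by
      have h := Real.log_le_log (show (0 : ℝ) < 2 ^ 11 by norm_num)
        (show (2 : ℝ) ^ 11 ≤ 3 ^ 7 by norm_num)
      rw [Real.log_pow, Real.log_pow] at h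
      push_cast at h
      linarith [Real.log_two_gt_d9]
    have hlog : 1.08 ≤ Real.log (Fintype.card Y) :=
      hlog3.trans (Real.log_le_log (by norm_num) h3)
    have he : Real.exp (-1) ≤ 0.368 := by
      linarith [Real.exp_neg_one_lt_d9]
    have hle : ∀ y, p y ≤ 1 := fun y =>
      hs ▸ Finset.single_le_sum (fun y _ => hp y) (Finset.mem_univ y)
    calc ∑ y, p y * (-Real.log (p y) - 0) ^ 2 ≤ ∑ _y : Y, 4 * Real.exp (-1) ^ 2 := by
          refine Finset.sum_le_sum fun y _ => ?_
          rw [sub_zero]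
          exact mul_log_sq_le (hp y) (hle y)
      _ = (Fintype.card Y : ℝ) * (4 * Real.exp (-1) ^ 2) := by simp
      _ ≤ (Fintype.card Y : ℝ) * (4 * 0.368 ^ 2) := by gcongr
      _ ≤ (Fintype.card Y : ℝ) * (1.08 ^ 2 / 2) := by gcongr; norm_num
      _ ≤ (Fintype.card Y : ℝ) * (Real.log (Fintype.card Y) ^ 2 / 2) := by gcongr
      _ = _ := by ring

/-! ### Concentration of empirical means -/

section Concentration

open ProbabilityTheory

variable {Z : Type*} [MeasurableSpace Z] {μ : Measure Z} {f : Z → ℝ} {b : ℝ}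

lemma integrable_of_abs_le [IsFiniteMeasure μ] (hf : Measurable f) (hb : ∀ z, |f z| ≤ b) :
    Integrable f μ :=
  Integrable.of_bound hf.aestronglyMeasurable b (ae_of_all _ hb)

lemma exp_le_taylor_two (z : ℝ) :
    Real.exp z ≤ 1 + z + z ^ 2 / 2 + |z| ^ 3 * Real.exp |z| := by
  have h := Complex.norm_exp_sub_sum_le_norm_mul_exp (z : ℂ) 3
  rw [Complex.norm_real, Real.norm_eq_abs, ← Complex.ofReal_exp] at h
  have h2 : (Real.exp z : ℂ) - ∑ m ∈ Finset.range 3, (z : ℂ) ^ m / (m.factorial : ℂ)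
      = ((Real.exp z - (1 + z + z ^ 2 / 2) : ℝ) : ℂ) := by
    simp [Finset.sum_range_succ]
  rw [h2, Complex.norm_real, Real.norm_eq_abs] at h
  linarith [le_abs_self (Real.exp z - (1 + z + z ^ 2 / 2))]

/-- Since `|s| ≤ 1/2`, the exponential in the remainder uses only half of `exp |y|`; the other half
absorbs `|y| ^ 3`, at the price `48 = 3! * 2 ^ 3`. -/
lemma exp_mul_le_taylor_two {s : ℝ} (hs : |s| ≤ 1 / 2) (y : ℝ) :
    Real.exp (s * y) ≤ 1 + s * y + s ^ 2 / 2 * y ^ 2 + 48 * |s| ^ 3 * Real.exp |y| := by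
  have h1 := exp_le_taylor_two (s * y)
  have h2 : |y| ^ 3 ≤ 48 * Real.exp (|y| / 2) := by
    have := Real.pow_div_factorial_le_exp (x := |y| / 2) (by positivity) 3
    norm_num [Nat.factorial] at this
    linarith
  have h3 : Real.exp |s * y| ≤ Real.exp (|y| / 2) := by
    rw [Real.exp_le_exp, abs_mul]
    nlinarith [abs_nonneg y]
  have h4 : |s * y| ^ 3 * Real.exp |s * y| ≤ 48 * |s| ^ 3 * Real.exp |y| := by
    calc |s * y| ^ 3 * Real.exp |s * y|
        = |s| ^ 3 * (|y| ^ 3 * Real.exp |s * y|) := by rw [abs_mul]; ring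
      _ ≤ |s| ^ 3 * (48 * Real.exp (|y| / 2) * Real.exp (|y| / 2)) := by gcongr
      _ = 48 * |s| ^ 3 * Real.exp |y| := by
        rw [mul_assoc, ← Real.exp_add, add_halves]; ring
  nlinarith

variable [IsProbabilityMeasure μ]

/-- For nonnegative `f` with mean `m`, `|f - m| ≤ f + m`, and `exp m ≤ M` by Jensen, so the cubic
remainder costs `M ^ 2`. The bound `b` serves integrability only and does not enter the estimate;
this keeps the remainder independent of the quantization. -/
lemma integral_exp_mul_sub_mean_le (hf : Measurable f) (hb : ∀ z, |f z| ≤ b) (h0 : ∀ z, 0 ≤ f z)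
    {M V : ℝ} (hM : ∫ z, Real.exp (f z) ∂μ ≤ M) (hV : Var[f; μ] ≤ V) {s : ℝ} (hs : |s| ≤ 1 / 2) :
    ∫ z, Real.exp (s * (f z - ∫ w, f w ∂μ)) ∂μ
      ≤ Real.exp (s ^ 2 * V / 2 + 48 * M ^ 2 * |s| ^ 3) := by
  set m := ∫ w, f w ∂μ with hm
  have hfi : Integrable f μ := integrable_of_abs_le hf hb
  have hm0 : 0 ≤ m := integral_nonneg h0
  have hmb : |m| ≤ b := by
    have := norm_integral_le_of_norm_le_const (μ := μ) (f := f) (C := b) (ae_of_all _ hb)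
    simpa using this
  have hei : Integrable (fun z => Real.exp (f z)) μ :=
    integrable_of_abs_le (b := Real.exp b) hf.exp fun z => by
      rw [Real.abs_exp]; exact Real.exp_le_exp.2 ((le_abs_self _).trans (hb z))
  have hem : Real.exp m ≤ M := by
    refine le_trans ?_ hM
    exact convexOn_exp.map_integral_le Real.continuous_exp.continuousOn isClosed_univ
      (ae_of_all _ fun _ => Set.mem_univ _) hfi hei
  have hM0 : 0 ≤ M := (Real.exp_pos _).le.trans hem
  have hdb : ∀ z, |f z - m| ≤ 2 * b := fun z =>
    (abs_sub _ _).trans (by linarith [hb z])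
  have hdi : Integrable (fun z => f z - m) μ := hfi.sub (integrable_const _)
  have hd2 : Integrable (fun z => (f z - m) ^ 2) μ :=
    integrable_of_abs_le (b := (2 * b) ^ 2) ((hf.sub_const m).pow_const 2) fun z => by
      rw [abs_pow]; gcongr; exact hdb z
  have hde : Integrable (fun z => Real.exp |f z - m|) μ :=
    integrable_of_abs_le (b := Real.exp (2 * b)) (by fun_prop) fun z => by
      rw [Real.abs_exp]; exact Real.exp_le_exp.2 (hdb z)
  have hse : Integrable (fun z => Real.exp (s * (f z - m))) μ :=
    integrable_of_abs_le (b := Real.exp (|s| * (2 * b))) (by fun_prop) fun z => by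
      rw [Real.abs_exp, Real.exp_le_exp]
      refine (le_abs_self _).trans ?_
      rw [abs_mul]; gcongr; exact hdb z
  have hvar : ∫ z, (f z - m) ^ 2 ∂μ ≤ V := by
    rwa [variance_eq_integral hf.aemeasurable] at hV
  have habs : ∫ z, Real.exp |f z - m| ∂μ ≤ M ^ 2 := by
    calc ∫ z, Real.exp |f z - m| ∂μ ≤ ∫ z, Real.exp (f z) * Real.exp m ∂μ := by
          refine integral_mono hde (hei.mul_const _) fun z => ?_
          simp only [← Real.exp_add, Real.exp_le_exp]
          rw [abs_le]; constructor <;> linarith [h0 z]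
      _ = (∫ z, Real.exp (f z) ∂μ) * Real.exp m := integral_mul_const _ _
      _ ≤ M * M := by gcongr
      _ = M ^ 2 := by ring
  have hmean : ∫ z, (f z - m) ∂μ = 0 := by
    rw [integral_sub hfi (integrable_const _)]; simp [hm]
  calc ∫ z, Real.exp (s * (f z - m)) ∂μ
      ≤ ∫ z, (1 + s * (f z - m) + s ^ 2 / 2 * (f z - m) ^ 2
          + 48 * |s| ^ 3 * Real.exp |f z - m|) ∂μ :=
        integral_mono hse ((((integrable_const _).add (hdi.const_mul _)).add
          (hd2.const_mul _)).add (hde.const_mul _)) fun z => exp_mul_le_taylor_two hs _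
    _ = 1 + s ^ 2 / 2 * ∫ z, (f z - m) ^ 2 ∂μ + 48 * |s| ^ 3 * ∫ z, Real.exp |f z - m| ∂μ := by
        have hi1 : Integrable (fun z => 1 + s * (f z - m)) μ :=
          (integrable_const _).add (hdi.const_mul _)
        have hi2 : Integrable (fun z => 1 + s * (f z - m) + s ^ 2 / 2 * (f z - m) ^ 2) μ :=
          hi1.add (hd2.const_mul _)
        rw [integral_add hi2 (hde.const_mul _), integral_add hi1 (hd2.const_mul _),
          integral_add (integrable_const _) (hdi.const_mul _), integral_const_mul,
          integral_const_mul, integral_const_mul, hmean]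
        simp
    _ ≤ 1 + s ^ 2 / 2 * V + 48 * |s| ^ 3 * M ^ 2 := by gcongr
    _ ≤ Real.exp (s ^ 2 * V / 2 + 48 * M ^ 2 * |s| ^ 3) := by
        refine le_trans (le_of_eq ?_) (Real.add_one_le_exp _)
        ring

/-- Chernoff's bound for sums of independent copies. -/
lemma pi_sum_gt_le {s E : ℝ} (hf : Measurable f) (hb : ∀ z, |f z| ≤ b)
    (hE : ∫ z, Real.exp (s * f z) ∂μ ≤ Real.exp E) (n : ℕ) {a L : ℝ} (ha : L + n * E ≤ a) :
    Measure.pi (fun _ : Fin n => μ) {S | a < s * ∑ i, f (S i)}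
      ≤ ENNReal.ofReal (Real.exp (-L)) := by
  set ν := Measure.pi (fun _ : Fin n => μ)
  have hg : ∀ S : Fin n → Z, Real.exp (s * ∑ i, f (S i)) = ∏ i, Real.exp (s * f (S i)) := by
    intro S; rw [Finset.mul_sum, Real.exp_sum]
  have hmeas : Measurable fun S : Fin n → Z => Real.exp (s * ∑ i, f (S i)) := by fun_prop
  have hint : Integrable (fun S : Fin n → Z => Real.exp (s * ∑ i, f (S i))) ν :=
    integrable_of_abs_le (b := Real.exp (|s| * (n * b))) hmeas fun S => by
      rw [Real.abs_exp, Real.exp_le_exp]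
      refine (le_abs_self _).trans ?_
      rw [abs_mul]
      gcongr
      refine (Finset.abs_sum_le_sum_abs _ _).trans ?_
      refine (Finset.sum_le_sum fun i _ => hb (S i)).trans ?_
      simp
  have hval : ∫ S, Real.exp (s * ∑ i, f (S i)) ∂ν ≤ Real.exp (n * E) := by
    simp_rw [hg]
    rw [integral_fintype_prod_eq_pow (fun z => Real.exp (s * f z)), Fintype.card_fin,
      Real.exp_nat_mul]
    gcongr
  have hmk := mul_meas_ge_le_integral_of_nonneg (μ := ν)
    (ae_of_all _ fun S => (Real.exp_pos (s * ∑ i, f (S i))).le) hint (Real.exp a)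
  have hsub : {S : Fin n → Z | a < s * ∑ i, f (S i)}
      ⊆ {S | Real.exp a ≤ Real.exp (s * ∑ i, f (S i))} := fun S hS =>
    Real.exp_le_exp.2 (le_of_lt hS)
  refine (measure_mono hsub).trans ?_
  rw [← ofReal_measureReal]
  apply ENNReal.ofReal_le_ofReal
  have h1 : Real.exp a * ν.real {S | Real.exp a ≤ Real.exp (s * ∑ i, f (S i))}
      ≤ Real.exp a * Real.exp (-L) := by
    refine hmk.trans (hval.trans ?_)
    rw [← Real.exp_add, Real.exp_le_exp]
    linarith
  exact le_of_mul_le_mul_left h1 (Real.exp_pos a)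

/-- `s = 2 * L / (C * √n)` is optimal for the quadratic part. If it exceeds `1/2`, then `C * √n < 4
* L`, and `s = 1/2` works because the `1 / n` terms of the deviation absorb everything. -/
lemma exists_chernoff_parameter {C L G : ℝ} (hC : 0 < C) (hL : 0 < L) (hG : 0 ≤ G) {n : ℕ}
    (hn : 0 < n) :
    ∃ s : ℝ, 0 < s ∧ s ≤ 1 / 2 ∧
      L + n * (s ^ 2 * (C ^ 2 / (2 * L)) / 2 + G * s ^ 3)
        ≤ s * (n * (C / √n + (4 * L + 4 * L ^ 2 * G / C ^ 2) / n)) := by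
  have hn' : (0 : ℝ) < n := by exact_mod_cast hn
  have hr : 0 < √(n : ℝ) := Real.sqrt_pos.2 hn'
  have hr2 : √(n : ℝ) ^ 2 = n := Real.sq_sqrt hn'.le
  set r := √(n : ℝ)
  rw [← hr2]
  by_cases h : 2 * L / (C * r) ≤ 1 / 2
  · refine ⟨2 * L / (C * r), by positivity, h, ?_⟩
    have h1 : L + r ^ 2 *
        ((2 * L / (C * r)) ^ 2 * (C ^ 2 / (2 * L)) / 2 + G * (2 * L / (C * r)) ^ 3)
        = 2 * L + (2 * L / (C * r)) * (4 * L ^ 2 * G / C ^ 2) := by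
      field_simp; ring
    have h2 : 2 * L / (C * r) * (r ^ 2 * (C / r + (4 * L + 4 * L ^ 2 * G / C ^ 2) / r ^ 2))
        = 2 * L + (2 * L / (C * r)) * (4 * L ^ 2 * G / C ^ 2) + (2 * L / (C * r)) * (4 * L) := by
      field_simp; ring
    rw [h1, h2]
    have : 0 ≤ (2 * L / (C * r)) * (4 * L) := by positivity
    linarith
  · refine ⟨1 / 2, by norm_num, le_rfl, ?_⟩
    push Not at h
    rw [lt_div_iff₀ (by positivity)] at h
    have h1 : C * r < 4 * L := by linarith
    have h2 : 1 / 2 * (r ^ 2 * (C / r + (4 * L + 4 * L ^ 2 * G / C ^ 2) / r ^ 2))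
        = C * r / 2 + 2 * L + 2 * L ^ 2 * G / C ^ 2 := by
      field_simp; ring
    have h3 : r ^ 2 * ((1 / 2) ^ 2 * (C ^ 2 / (2 * L)) / 2) ≤ C * r / 4 := by
      have : r ^ 2 * ((1 / 2) ^ 2 * (C ^ 2 / (2 * L)) / 2) = (C * r) * (C * r) / (16 * L) := by
        field_simp; ring
      rw [this, div_le_iff₀ (by positivity)]
      nlinarith [mul_pos hC hr]
    have h4 : r ^ 2 * (G * (1 / 2) ^ 3) ≤ 2 * L ^ 2 * G / C ^ 2 := by
      rw [le_div_iff₀ (by positivity)]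
      have : (C * r) ^ 2 ≤ (4 * L) ^ 2 := by gcongr
      nlinarith [mul_le_mul_of_nonneg_left this hG]
    have h5 : 0 < C * r := by positivity
    rw [h2, mul_add]
    linarith

/-- A Bernstein inequality for a nonnegative variable with an exponential moment: the leading
deviation `C / √n` corresponds to the variance bound `C ^ 2 / (2 * L)`. -/
lemma pi_abs_mean_sub_gt_le (hf : Measurable f) (hb : ∀ z, |f z| ≤ b) (h0 : ∀ z, 0 ≤ f z)
    {M C L : ℝ} (hC : 0 < C) (hL : 0 < L) (hM : ∫ z, Real.exp (f z) ∂μ ≤ M)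
    (hV : Var[f; μ] ≤ C ^ 2 / (2 * L)) {n : ℕ} (hn : 0 < n) :
    Measure.pi (fun _ : Fin n => μ)
        {S | C / √n + (4 * L + 4 * L ^ 2 * (48 * M ^ 2) / C ^ 2) / n
          < |1 / (n : ℝ) * ∑ i, f (S i) - ∫ z, f z ∂μ|}
      ≤ 2 * ENNReal.ofReal (Real.exp (-L)) := by
  obtain ⟨s, hs0, hs, hle⟩ := exists_chernoff_parameter hC hL (show 0 ≤ 48 * M ^ 2 by positivity) hn
  set t := C / √n + (4 * L + 4 * L ^ 2 * (48 * M ^ 2) / C ^ 2) / n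
  set m := ∫ z, f z ∂μ
  have hn' : (0 : ℝ) < n := by exact_mod_cast hn
  have hd : Measurable fun z => f z - m := hf.sub_const m
  have hdb : ∀ z, |f z - m| ≤ b + |m| := fun z => (abs_sub _ _).trans (by linarith [hb z])
  have key : ∀ σ : ℝ, |σ| = s →
      Measure.pi (fun _ : Fin n => μ) {S | s * (n * t) < σ * ∑ i, (f (S i) - m)}
        ≤ ENNReal.ofReal (Real.exp (-L)) := by
    intro σ hσ
    refine pi_sum_gt_le hd hdb
      (integral_exp_mul_sub_mean_le hf hb h0 hM hV (hσ.le.trans hs)) n (le_trans (le_of_eq ?_) hle)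
    rw [hσ, ← sq_abs σ, hσ]
  have hsub : {S : Fin n → Z | t < |1 / (n : ℝ) * ∑ i, f (S i) - m|}
      ⊆ {S | s * (n * t) < s * ∑ i, (f (S i) - m)}
        ∪ {S | s * (n * t) < (-s) * ∑ i, (f (S i) - m)} := by
    intro S hS
    have hsum : ∑ i, (f (S i) - m) = n * (1 / (n : ℝ) * ∑ i, f (S i) - m) := by
      rw [Finset.sum_sub_distrib]
      simp
      field_simp
    simp only [Set.mem_union, Set.mem_ofPred_eq, hsum] at hS ⊢
    rcases lt_abs.1 hS with h | h
    · left; gcongr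
    · right
      rw [neg_mul, ← mul_neg, ← mul_neg]; gcongr
  refine (measure_mono hsub).trans ((measure_union_le _ _).trans ?_)
  rw [two_mul]
  exact add_le_add (key s (abs_of_pos hs0)) (key (-s) (by rw [abs_neg, abs_of_pos hs0]))

/-- Chebyshev's inequality for empirical means, allowing a vanishing second moment. -/
lemma pi_abs_mean_sub_gt_le_of_second_moment (hf : Measurable f) (hb : ∀ z, |f z| ≤ b)
    {v ρ : ℝ} (hv : ∫ z, f z ^ 2 ∂μ ≤ v) (hρ : 0 < ρ) {n : ℕ} (hn : 0 < n) :
    Measure.pi (fun _ : Fin n => μ)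
        {S | √(v / ρ) / √n < |1 / (n : ℝ) * ∑ i, f (S i) - ∫ z, f z ∂μ|}
      ≤ ENNReal.ofReal ρ := by
  set ν := Measure.pi (fun _ : Fin n => μ)
  have hn' : (0 : ℝ) < n := by exact_mod_cast hn
  have hL2 : MemLp f 2 μ := MemLp.of_bound hf.aestronglyMeasurable b (ae_of_all _ hb)
  set A : (Fin n → Z) → ℝ := fun S => 1 / (n : ℝ) * ∑ i, f (S i) with hA
  have hAeq : A = fun S => 1 / (n : ℝ) * (∑ i, fun S : Fin n → Z => f (S i)) S := by
    ext S; simp [hA]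
  have hAm : Measurable A := by fun_prop
  have hAL2 : MemLp A 2 ν := by
    refine MemLp.of_bound hAm.aestronglyMeasurable b (ae_of_all _ fun S => ?_)
    rw [Real.norm_eq_abs, hA]
    simp only
    rw [abs_mul, abs_of_pos (by positivity), one_div, inv_mul_le_iff₀ hn']
    refine (Finset.abs_sum_le_sum_abs _ _).trans ?_
    refine (Finset.sum_le_sum fun i _ => hb (S i)).trans ?_
    simp
  have hAmean : ∫ S, A S ∂ν = ∫ z, f z ∂μ := by
    simp only [hA]
    rw [integral_const_mul, integral_finsetSum]
    · have : ∀ i : Fin n, ∫ S, f (S i) ∂ν = ∫ z, f z ∂μ := fun i =>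
        integral_comp_eval (μ := fun _ : Fin n => μ) hf.aestronglyMeasurable
      simp_rw [this]
      simp
      field_simp
    · intro i _
      exact integrable_comp_eval (μ := fun _ : Fin n => μ) (integrable_of_abs_le hf hb)
  have hAvar : Var[A; ν] ≤ v / n := by
    rw [hAeq, variance_const_mul,
      variance_sum_pi (μ := fun _ : Fin n => μ) (X := fun _ => f) fun _ => hL2]
    have h1 : Var[f; μ] ≤ v := (variance_le_expectation_sq hf.aestronglyMeasurable).trans hv
    simp only [Finset.sum_const, Finset.card_univ, Fintype.card_fin, nsmul_eq_mul]
    calc (1 / (n : ℝ)) ^ 2 * (n * Var[f; μ]) = Var[f; μ] / n := by field_simp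
      _ ≤ v / n := by gcongr
  have hv0 : 0 ≤ v := (integral_nonneg fun z => sq_nonneg _).trans hv
  rw [← hAmean]
  change ν {S | √(v / ρ) / √n < |A S - ∫ S, A S ∂ν|} ≤ _
  -- Chebyshev's inequality requires a positive threshold. For `v = 0` the threshold vanishes, but
  -- then the empirical mean is almost surely constant.
  rcases hv0.eq_or_lt with rfl | hv0
  · have hz : Var[A; ν] = 0 := le_antisymm (by simpa using hAvar) (variance_nonneg _ _)
    have hae := ae_eq_integral_of_variance_eq_zero hAL2 hz
    refine le_trans (le_of_eq ?_) zero_le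
    have hsub : {S | √(0 / ρ) / √n < |A S - ∫ S, A S ∂ν|} ⊆ {S | A S = ∫ S, A S ∂ν}ᶜ := by
      intro S hS hS'
      simp only [Set.mem_ofPred_eq, zero_div, Real.sqrt_zero, abs_pos] at hS hS'
      exact hS (sub_eq_zero.2 hS')
    exact measure_mono_null hsub hae
  · have hc : 0 < √(v / ρ) / √n := by positivity
    have hsub : {S | √(v / ρ) / √n < |A S - ∫ S, A S ∂ν|}
        ⊆ {S | √(v / ρ) / √n ≤ |A S - ∫ S, A S ∂ν|} := by
      intro S hS
      simp only [Set.mem_ofPred_eq] at hS ⊢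
      exact hS.le
    refine (measure_mono hsub).trans
      ((meas_ge_le_variance_div_sq hAL2 hc).trans (ENNReal.ofReal_le_ofReal ?_))
    rw [div_pow, Real.sq_sqrt (by positivity), Real.sq_sqrt hn'.le]
    calc Var[A; ν] / (v / ρ / n) ≤ (v / n) / (v / ρ / n) := by gcongr
      _ = ρ := by field_simp

end Concentration

section Model

variable {X Y U : Type*} [MeasurableSpace X] [MeasurableSpace U] {vol : Measure U}

/-! ### Encoders and decoders -/

section EncoderDecoder

lemma Encoder.measurable_dens_right (q : Encoder X vol) (x : X) :
    Measurable fun u => (q.dens x u : ℝ≥0∞) :=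
  (q.measurable_dens.comp measurable_prodMk_left).coe_nnreal_ennreal

instance Encoder.isProbabilityMeasure_law (q : Encoder X vol) (x : X) :
    IsProbabilityMeasure (q.law x) :=
  ⟨by rw [Encoder.law, withDensity_apply _ MeasurableSet.univ, Measure.restrict_univ,
    q.lintegral_dens]⟩

lemma Encoder.lintegral_law (q : Encoder X vol) (x : X) {g : U → ℝ≥0∞} (hg : Measurable g) :
    ∫⁻ u, g u ∂(q.law x) = ∫⁻ u, (q.dens x u : ℝ≥0∞) * g u ∂vol :=
  lintegral_withDensity_eq_lintegral_mul _ (q.measurable_dens_right x) hg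

variable [Fintype Y]

lemma Decoder.prob_le_one (Q : Decoder U Y) (u : U) (y : Y) : Q.prob u y ≤ 1 :=
  Q.sum_prob u ▸ Finset.single_le_sum (fun y _ => Q.prob_nonneg u y) (Finset.mem_univ y)

lemma Decoder.minProb_le (Q : Decoder U Y) (u : U) (y : Y) : Q.minProb ≤ Q.prob u y :=
  ciInf_le (f := fun z : U × Y => Q.prob z.1 z.2)
    ⟨0, by rintro _ ⟨z, rfl⟩; exact Q.prob_nonneg z.1 z.2⟩ (u, y)

lemma Decoder.abs_log_prob_le {Q : Decoder U Y} (hQ : 0 < Q.minProb) (u : U) (y : Y) :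
    |(-Real.log (Q.prob u y))| ≤ -Real.log Q.minProb := by
  rw [abs_of_nonneg (neg_nonneg.2 (Real.log_nonpos (Q.prob_nonneg u y) (Q.prob_le_one u y)))]
  exact neg_le_neg (Real.log_le_log hQ (Q.minProb_le u y))

lemma Decoder.measurable_neg_log (Q : Decoder U Y) (y : Y) :
    Measurable fun u => -Real.log (Q.prob u y) :=
  (Q.measurable_prob y).log.neg

lemma Decoder.integrable_neg_log {Q : Decoder U Y} (hQ : 0 < Q.minProb) (q : Encoder X vol)
    (x : X) (y : Y) : Integrable (fun u => -Real.log (Q.prob u y)) (q.law x) :=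
  integrable_of_abs_le (Q.measurable_neg_log y) fun u => Decoder.abs_log_prob_le hQ u y

lemma abs_loss_le (q : Encoder X vol) {Q : Decoder U Y} (hQ : 0 < Q.minProb) (x : X) (y : Y) :
    |loss q Q x y| ≤ -Real.log Q.minProb := by
  have := norm_integral_le_of_norm_le_const (μ := q.law x)
    (f := fun u => -Real.log (Q.prob u y)) (ae_of_all _ fun u => Decoder.abs_log_prob_le hQ u y)
  simpa [loss] using this

lemma measurable_loss [MeasurableSpace Y] [MeasurableSingletonClass Y] [SFinite vol]
    (q : Encoder X vol) (Q : Decoder U Y) : Measurable fun z : X × Y => loss q Q z.1 z.2 := by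
  refine measurable_from_prod_countable_left fun y => ?_
  have h : ∀ x, loss q Q x y = ∫ u, (q.dens x u : ℝ) * -Real.log (Q.prob u y) ∂vol := by
    intro x
    have hd : Measurable fun u => q.dens x u := q.measurable_dens.comp measurable_prodMk_left
    rw [loss, Encoder.law, integral_withDensity_eq_integral_smul hd]
    rfl
  simp only [h]
  have hm : StronglyMeasurable (Function.uncurry fun (x : X) (u : U) =>
      (q.dens x u : ℝ) * -Real.log (Q.prob u y)) := by
    refine Measurable.stronglyMeasurable ?_
    exact (q.measurable_dens.coe_nnreal_real).mul ((Q.measurable_neg_log y).comp measurable_snd)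
  exact hm.integral_prod_right.measurable

end EncoderDecoder

/-! ### The quantizer -/

section Quantizer

variable {K : ℕ} (c : Quantization X Y K)

lemma Quantization.exists_mem_cell (z : X × Y) : ∃ k, z.1 ∈ c.cell k z.2 := by
  have : z.1 ∈ ⋃ k, c.cell k z.2 := by rw [c.iUnion_cell]; trivial
  exact Set.mem_iUnion.1 this

/-- The quantizer, mapping a labelled input to the index of its cell and its label. -/
noncomputable def Quantization.quantize (z : X × Y) : Fin K × Y :=
  ((c.exists_mem_cell z).choose, z.2)

lemma Quantization.mem_cell_quantize (z : X × Y) : z.1 ∈ c.cell (c.quantize z).1 z.2 :=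
  (c.exists_mem_cell z).choose_spec

lemma Quantization.preimage_quantize (k : Fin K) (y : Y) :
    c.quantize ⁻¹' {(k, y)} = c.cell k y ×ˢ {y} := by
  ext ⟨x, y'⟩
  simp only [Set.mem_preimage, Set.mem_singleton_iff, Set.mem_prod]
  constructor
  · intro h
    have hy : y' = y := congrArg Prod.snd h
    have hk : (c.quantize (x, y')).1 = k := congrArg Prod.fst h
    subst hy
    exact ⟨hk ▸ c.mem_cell_quantize (x, y'), rfl⟩
  · rintro ⟨hx, rfl⟩
    refine Prod.ext ?_ rfl
    by_contra hne
    exact Set.disjoint_left.1 (c.disjoint_cell y' hne) (c.mem_cell_quantize (x, y')) hx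

lemma exists_abs_comp_quantize_le [Fintype Y] (F : Fin K × Y → ℝ) :
    ∃ b, ∀ z, |F (c.quantize z)| ≤ b :=
  ⟨∑ a, |F a|, fun z => Finset.single_le_sum (f := fun a => |F a|) (fun _ _ => abs_nonneg _)
    (Finset.mem_univ (c.quantize z))⟩

lemma abs_loss_sub_loss_center_le [Fintype Y] (q : Encoder X vol) {Q : Decoder U Y}
    (hQ : 0 < Q.minProb) (z : X × Y) :
    |loss q Q z.1 z.2 - loss q Q (c.center (c.quantize z).1 z.2) z.2| ≤ epsilonK q Q c := by
  -- A real `sSup` dominates its elements only when the set is bounded above; the positive lower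
  -- bound on the decoder provides this.
  refine le_csSup ⟨2 * -Real.log Q.minProb, ?_⟩
    ⟨(c.quantize z).1, z.2, z.1, c.mem_cell_quantize z, rfl⟩
  rintro _ ⟨k, y, x, -, rfl⟩
  refine (abs_sub _ _).trans ?_
  linarith [abs_loss_le q hQ x y, abs_loss_le q hQ (c.center k y) y]

variable [MeasurableSpace Y] [Fintype Y] [MeasurableSingletonClass Y]

lemma Quantization.measurable_quantize : Measurable c.quantize := by
  refine measurable_to_countable' fun ⟨k, y⟩ => ?_
  rw [c.preimage_quantize]
  exact (c.measurableSet_cell k y).prod (measurableSet_singleton y)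

variable (P : Measure (X × Y)) [IsProbabilityMeasure P]

lemma Quantization.integral_quantize (F : Fin K × Y → ℝ) :
    ∫ z, F (c.quantize z) ∂P = ∑ k, ∑ y, P.real (c.cell k y ×ˢ {y}) * F (k, y) := by
  have := Measure.isProbabilityMeasure_map (μ := P) c.measurable_quantize.aemeasurable
  rw [← integral_map (φ := c.quantize) (f := F) c.measurable_quantize.aemeasurable
    (Measurable.of_discrete.aestronglyMeasurable), integral_fintype Integrable.of_finite,
    Fintype.sum_prod_type]
  simp only [smul_eq_mul]
  refine Finset.sum_congr rfl fun k _ => Finset.sum_congr rfl fun y _ => ?_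
  rw [map_measureReal_apply c.measurable_quantize (measurableSet_singleton _),
    c.preimage_quantize]

lemma Quantization.sum_cell : ∑ k, ∑ y, P.real (c.cell k y ×ˢ {y}) = 1 := by
  have := c.integral_quantize P fun _ => 1
  simpa using this.symm

end Quantizer

/-! ### The quantized joint law -/

section Quantized

variable [MeasurableSpace Y] {K : ℕ} (P : Measure (X × Y)) (q : Encoder X vol)
  (c : Quantization X Y K)

lemma jointD_nonneg (u : U) (y : Y) : 0 ≤ jointD P q c u y :=
  Finset.sum_nonneg fun _ _ => by positivity

lemma measurable_jointD (y : Y) : Measurable fun u => jointD P q c u y := by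
  refine Finset.measurable_fun_sum _ fun k _ => Measurable.mul_const ?_ _
  exact (q.measurable_dens.comp measurable_prodMk_left).coe_nnreal_real

variable [Fintype Y]

lemma densD_nonneg (u : U) : 0 ≤ densD P q c u :=
  Finset.sum_nonneg fun _ _ => jointD_nonneg P q c u _

lemma jointD_le_densD (u : U) (y : Y) : jointD P q c u y ≤ densD P q c u :=
  Finset.single_le_sum (fun y _ => jointD_nonneg P q c u y) (Finset.mem_univ y)

lemma decoderD_nonneg (u : U) (y : Y) : 0 ≤ decoderD P q c u y :=
  div_nonneg (jointD_nonneg P q c u y) (densD_nonneg P q c u)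

lemma decoderD_le_one (u : U) (y : Y) : decoderD P q c u y ≤ 1 :=
  div_le_one_of_le₀ (jointD_le_densD P q c u y) (densD_nonneg P q c u)

lemma sum_decoderD {u : U} (hu : densD P q c u ≠ 0) : ∑ y, decoderD P q c u y = 1 := by
  simp only [decoderD]
  rw [← Finset.sum_div]
  exact div_self hu

lemma jointD_eq (u : U) (y : Y) : jointD P q c u y = densD P q c u * decoderD P q c u y := by
  -- Where the density vanishes, the quotient is `0` by convention and each nonnegative summand
  -- vanishes too.
  by_cases hu : densD P q c u = 0
  · have h1 := jointD_le_densD P q c u y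
    rw [hu] at h1 ⊢
    rw [zero_mul]
    exact le_antisymm h1 (jointD_nonneg P q c u y)
  · rw [decoderD, mul_div_cancel₀ _ hu]

lemma measurable_densD : Measurable fun u => densD P q c u :=
  Finset.measurable_fun_sum _ fun y _ => measurable_jointD P q c y

lemma measurable_decoderD (y : Y) : Measurable fun u => decoderD P q c u y :=
  (measurable_jointD P q c y).div (measurable_densD P q c)

/-- Two descriptions of one expectation: draw the cell and label and then `U` from the centroid, or
use the joint density of `(U, Y)`. -/
lemma sum_lintegral_law (φ : U → Y → ℝ≥0∞) (hφ : ∀ y, Measurable fun u => φ u y) :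
    ∑ k, ∑ y, ENNReal.ofReal (P.real (c.cell k y ×ˢ {y})) * ∫⁻ u, φ u y ∂(q.law (c.center k y))
      = ∫⁻ u, ∑ y, ENNReal.ofReal (jointD P q c u y) * φ u y ∂vol := by
  have hm : ∀ k y, Measurable fun u => (q.dens (c.center k y) u : ℝ≥0∞) * φ u y := fun k y =>
    (q.measurable_dens_right _).mul (hφ y)
  have h1 : ∀ u y, ENNReal.ofReal (jointD P q c u y) * φ u y
      = ∑ k, ENNReal.ofReal (P.real (c.cell k y ×ˢ {y}))
          * ((q.dens (c.center k y) u : ℝ≥0∞) * φ u y) := by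
    intro u y
    rw [jointD, ENNReal.ofReal_sum_of_nonneg (fun _ _ => by positivity), Finset.sum_mul]
    refine Finset.sum_congr rfl fun k _ => ?_
    rw [ENNReal.ofReal_mul (by positivity), ENNReal.ofReal_coe_nnreal]
    ring
  simp only [h1]
  rw [lintegral_finsetSum _ fun y _ => Finset.measurable_fun_sum _ fun k _ => (hm k y).const_mul _,
    Finset.sum_comm]
  refine Finset.sum_congr rfl fun y _ => ?_
  rw [lintegral_finsetSum _ fun k _ => (hm k y).const_mul _]
  refine Finset.sum_congr rfl fun k _ => ?_
  rw [lintegral_const_mul _ (hm k y), q.lintegral_law _ (hφ y)]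

/-- Conditioning on `U`: given `u`, the label has law `decoderD`, so it is enough to bound the
conditional expectation. -/
lemma sum_lintegral_law_le {G : U → Y → ℝ} (hG : ∀ y, Measurable fun u => G u y) {B : U → ℝ}
    (hG0 : ∀ u y, 0 ≤ G u y)
    (h : ∀ u, densD P q c u ≠ 0 → ∑ y, decoderD P q c u y * G u y ≤ B u) :
    ∑ k, ∑ y, ENNReal.ofReal (P.real (c.cell k y ×ˢ {y}))
        * ∫⁻ u, ENNReal.ofReal (G u y) ∂(q.law (c.center k y))
      ≤ ∫⁻ u, ENNReal.ofReal (densD P q c u) * ENNReal.ofReal (B u) ∂vol := by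
  rw [sum_lintegral_law P q c _ fun y => (hG y).ennreal_ofReal]
  refine lintegral_mono fun u => ?_
  simp only
  by_cases hu : densD P q c u = 0
  · simp [jointD_eq, hu]
  rw [← ENNReal.ofReal_mul (densD_nonneg P q c u)]
  calc ∑ y, ENNReal.ofReal (jointD P q c u y) * ENNReal.ofReal (G u y)
      = ENNReal.ofReal (densD P q c u * ∑ y, decoderD P q c u y * G u y) := by
        rw [Finset.mul_sum, ENNReal.ofReal_sum_of_nonneg]
        · refine Finset.sum_congr rfl fun y _ => ?_
          rw [← ENNReal.ofReal_mul (jointD_nonneg P q c u y), jointD_eq, mul_assoc]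
        · exact fun y _ => mul_nonneg (densD_nonneg P q c u)
            (mul_nonneg (decoderD_nonneg P q c u y) (hG0 u y))
    _ ≤ _ := by
        gcongr
        · exact densD_nonneg P q c u
        · exact h u hu

lemma lintegral_densD [MeasurableSingletonClass Y] [IsProbabilityMeasure P] :
    ∫⁻ u, ENNReal.ofReal (densD P q c u) ∂vol = 1 := by
  have h := sum_lintegral_law P q c (fun _ _ => 1) fun _ => measurable_const
  simp only [lintegral_const, measure_univ, mul_one] at h
  have h2 : ∀ u, ∑ y, ENNReal.ofReal (jointD P q c u y) = ENNReal.ofReal (densD P q c u) :=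
    fun u => (ENNReal.ofReal_sum_of_nonneg fun y _ => jointD_nonneg P q c u y).symm
  simp only [h2] at h
  rw [← h, ← ENNReal.ofReal_one, ← c.sum_cell P,
    ENNReal.ofReal_sum_of_nonneg fun k _ => Finset.sum_nonneg fun y _ => by positivity]
  exact Finset.sum_congr rfl fun k _ =>
    (ENNReal.ofReal_sum_of_nonneg fun y _ => by positivity).symm

lemma lintegral_densD_mul_const [MeasurableSingletonClass Y] [IsProbabilityMeasure P] (B : ℝ) :
    ∫⁻ u, ENNReal.ofReal (densD P q c u) * ENNReal.ofReal B ∂vol = ENNReal.ofReal B := by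
  rw [lintegral_mul_const _ (measurable_densD P q c).ennreal_ofReal, lintegral_densD, one_mul]

/-- Jensen's inequality without integrability of `g ∘ φ`: otherwise the right-hand side is `∞`. -/
lemma ofReal_map_integral_le {Ω : Type*} [MeasurableSpace Ω] {ρ : Measure Ω}
    [IsProbabilityMeasure ρ] {g : ℝ → ℝ} (hg : ConvexOn ℝ Set.univ g) (hgc : Continuous g)
    (hg0 : ∀ x, 0 ≤ g x) {φ : Ω → ℝ} (hφ : Integrable φ ρ) :
    ENNReal.ofReal (g (∫ ω, φ ω ∂ρ)) ≤ ∫⁻ ω, ENNReal.ofReal (g (φ ω)) ∂ρ := by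
  by_cases hi : Integrable (fun ω => g (φ ω)) ρ
  · rw [← ofReal_integral_eq_lintegral_ofReal hi (ae_of_all _ fun ω => hg0 _)]
    exact ENNReal.ofReal_le_ofReal (hg.map_integral_le hgc.continuousOn isClosed_univ
      (ae_of_all _ fun _ => Set.mem_univ _) hφ hi)
  · have hm : AEStronglyMeasurable (fun ω => g (φ ω)) ρ :=
      hgc.comp_aestronglyMeasurable hφ.aestronglyMeasurable
    have htop : ∫⁻ ω, ENNReal.ofReal (g (φ ω)) ∂ρ = ⊤ := by
      by_contra hne
      exact hi ((lintegral_ofReal_ne_top_iff_integrable hm (ae_of_all _ fun ω => hg0 _)).1 hne)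
    rw [htop]
    exact le_top

/-- Jensen's inequality for the average of a function of `(U, Y)` over the representation of a
cell. -/
lemma ofReal_integral_quantize_le [MeasurableSingletonClass Y] [IsProbabilityMeasure P]
    {g : ℝ → ℝ} (hg : ConvexOn ℝ Set.univ g) (hgc : Continuous g) (hg0 : ∀ x, 0 ≤ g x)
    {φ : U → Y → ℝ} (hφ : ∀ y, Measurable fun u => φ u y) {F : Fin K × Y → ℝ}
    (hF : ∀ k y, P.real (c.cell k y ×ˢ {y}) ≠ 0 →
      Integrable (fun u => φ u y) (q.law (c.center k y)) ∧
        F (k, y) = ∫ u, φ u y ∂(q.law (c.center k y)))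
    {B : U → ℝ} (h : ∀ u, densD P q c u ≠ 0 → ∑ y, decoderD P q c u y * g (φ u y) ≤ B u) :
    ENNReal.ofReal (∫ z, g (F (c.quantize z)) ∂P)
      ≤ ∫⁻ u, ENNReal.ofReal (densD P q c u) * ENNReal.ofReal (B u) ∂vol := by
  refine le_trans ?_ (sum_lintegral_law_le P q c (G := fun u y => g (φ u y))
    (fun y => hgc.measurable.comp (hφ y)) (fun u y => hg0 _) h)
  rw [c.integral_quantize P fun a => g (F a), ENNReal.ofReal_sum_of_nonneg fun k _ =>
    Finset.sum_nonneg fun y _ => mul_nonneg measureReal_nonneg (hg0 _)]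
  refine Finset.sum_le_sum fun k _ => ?_
  rw [ENNReal.ofReal_sum_of_nonneg fun y _ => mul_nonneg measureReal_nonneg (hg0 _)]
  refine Finset.sum_le_sum fun y _ => ?_
  rw [ENNReal.ofReal_mul measureReal_nonneg]
  by_cases hw : P.real (c.cell k y ×ˢ {y}) = 0
  · simp [hw]
  · obtain ⟨hi, he⟩ := hF k y hw
    gcongr
    rw [he]
    exact ofReal_map_integral_le hg hgc hg0 hi

end Quantized

end Model

section Bound

open ProbabilityTheory

variable {X Y U : Type*} [MeasurableSpace X] [MeasurableSpace U] {vol : Measure U}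
  [MeasurableSpace Y] [Fintype Y] {K : ℕ} (P : Measure (X × Y)) (q : Encoder X vol)
  (c : Quantization X Y K)

/-! ### The information content of the quantized labels -/

lemma mul_exp_neg_log_le {p : ℝ} (hp : 0 ≤ p) : p * Real.exp (-Real.log p) ≤ 1 := by
  rcases hp.eq_or_lt with rfl | hp
  · simp
  · rw [Real.exp_neg, Real.exp_log hp, mul_inv_cancel₀ hp.ne']

/-- Each summand is `p * (1 / p)`, or `0` when `p = 0`. This exponential moment replaces a lower
bound on `Q^D`. -/
lemma sum_decoderD_mul_exp_le (u : U) :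
    ∑ y, decoderD P q c u y * Real.exp (-Real.log (decoderD P q c u y)) ≤ Fintype.card Y := by
  refine (Finset.sum_le_sum fun y _ => mul_exp_neg_log_le (decoderD_nonneg P q c u y)).trans ?_
  simp

lemma measurable_neg_log_decoderD (y : Y) :
    Measurable fun u => -Real.log (decoderD P q c u y) :=
  (measurable_decoderD P q c y).log.neg

/-- The expected information content `E[-log Q^D(y|U)]` of the label of a cell, set to `0` for
cells of probability zero. -/
noncomputable def cellInfo (a : Fin K × Y) : ℝ :=
  if P.real (c.cell a.1 a.2 ×ˢ {a.2}) = 0 then 0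
  else ∫ u, -Real.log (decoderD P q c u a.2) ∂(q.law (c.center a.1 a.2))

lemma cellInfo_nonneg (a : Fin K × Y) : 0 ≤ cellInfo P q c a := by
  rw [cellInfo]
  split_ifs
  · exact le_rfl
  · exact integral_nonneg fun u => neg_nonneg.2
      (Real.log_nonpos (decoderD_nonneg P q c u _) (decoderD_le_one P q c u _))

lemma cellInfo_eq {k : Fin K} {y : Y} (hw : P.real (c.cell k y ×ˢ {y}) ≠ 0) :
    cellInfo P q c (k, y) = ∫ u, -Real.log (decoderD P q c u y) ∂(q.law (c.center k y)) :=
  if_neg hw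

variable [MeasurableSingletonClass Y] [IsProbabilityMeasure P]

/-- A cell of positive weight inherits a finite exponential moment from the total one, and `x ≤ exp
x` dominates the integrand. -/
lemma integrable_neg_log_decoderD {k : Fin K} {y : Y} (hw : P.real (c.cell k y ×ˢ {y}) ≠ 0) :
    Integrable (fun u => -Real.log (decoderD P q c u y)) (q.law (c.center k y)) := by
  have hm := measurable_neg_log_decoderD P q c
  have h := sum_lintegral_law_le P q c (G := fun u y => Real.exp (-Real.log (decoderD P q c u y)))
    (B := fun _ => Fintype.card Y) (fun y => (hm y).exp) (fun _ _ => (Real.exp_pos _).le)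
    fun u _ => sum_decoderD_mul_exp_le P q c u
  rw [lintegral_densD_mul_const] at h
  have hle : ENNReal.ofReal (P.real (c.cell k y ×ˢ {y}))
      * ∫⁻ u, ENNReal.ofReal (Real.exp (-Real.log (decoderD P q c u y))) ∂(q.law (c.center k y))
        ≤ ENNReal.ofReal (Fintype.card Y) := by
    refine le_trans ?_ h
    refine le_trans ?_ (Finset.single_le_sum (fun _ _ => zero_le) (Finset.mem_univ k))
    exact Finset.single_le_sum (f := fun y => ENNReal.ofReal (P.real (c.cell k y ×ˢ {y}))
      * ∫⁻ u, ENNReal.ofReal (Real.exp (-Real.log (decoderD P q c u y))) ∂(q.law (c.center k y)))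
      (fun _ _ => zero_le) (Finset.mem_univ y)
  have hne : ∫⁻ u, ENNReal.ofReal (Real.exp (-Real.log (decoderD P q c u y)))
      ∂(q.law (c.center k y)) ≠ ⊤ := by
    intro htop
    rw [htop, ENNReal.mul_top] at hle
    · exact ENNReal.ofReal_ne_top (top_le_iff.1 hle)
    · rw [Ne, ENNReal.ofReal_eq_zero, not_le]
      exact lt_of_le_of_ne measureReal_nonneg hw.symm
  have hexp := (lintegral_ofReal_ne_top_iff_integrable (hm y).exp.aestronglyMeasurable
    (ae_of_all _ fun _ => (Real.exp_pos _).le)).1 hne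
  refine hexp.mono' (hm y).aestronglyMeasurable (ae_of_all _ fun u => ?_)
  rw [Real.norm_of_nonneg (neg_nonneg.2
    (Real.log_nonpos (decoderD_nonneg P q c u y) (decoderD_le_one P q c u y)))]
  linarith [Real.add_one_le_exp (-Real.log (decoderD P q c u y))]

lemma integral_exp_cellInfo_le :
    ∫ z, Real.exp (cellInfo P q c (c.quantize z)) ∂P ≤ Fintype.card Y := by
  have h := ofReal_integral_quantize_le P q c convexOn_exp Real.continuous_exp
    (fun x => (Real.exp_pos x).le) (measurable_neg_log_decoderD P q c) (F := cellInfo P q c)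
    (fun k y hw => ⟨integrable_neg_log_decoderD P q c hw, cellInfo_eq P q c hw⟩)
    (B := fun _ => Fintype.card Y) fun u _ => sum_decoderD_mul_exp_le P q c u
  rw [lintegral_densD_mul_const] at h
  exact (ENNReal.ofReal_le_ofReal_iff (by positivity)).1 h

lemma measurable_comp_quantize (F : Fin K × Y → ℝ) : Measurable fun z => F (c.quantize z) :=
  Measurable.of_discrete.comp c.measurable_quantize

/-- Variance ignores shifts, and Jensen applies to `(x - a) ^ 2`. One centre `a` must serve all the
conditional laws `decoderD P q c u` simultaneously. -/
lemma variance_cellInfo_le [Nonempty Y] :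
    Var[fun z => cellInfo P q c (c.quantize z); P]
      ≤ (Fintype.card Y : ℝ) / 2 * Real.log (Fintype.card Y) ^ 2 := by
  obtain ⟨a, ha⟩ := exists_second_moment_le Y
  have hconv : ConvexOn ℝ Set.univ fun x : ℝ => (x - a) ^ 2 := by
    have := (even_two.convexOn_pow (𝕜 := ℝ)).translate_right (-a)
    simpa [Function.comp_def, neg_add_eq_sub] using this
  have h := ofReal_integral_quantize_le P q c hconv (by fun_prop)
    (fun x => sq_nonneg _) (measurable_neg_log_decoderD P q c) (F := cellInfo P q c)
    (fun k y hw => ⟨integrable_neg_log_decoderD P q c hw, cellInfo_eq P q c hw⟩)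
    (B := fun _ => (Fintype.card Y : ℝ) / 2 * Real.log (Fintype.card Y) ^ 2)
    fun u hu => ha _ (decoderD_nonneg P q c u) (sum_decoderD P q c hu)
  rw [lintegral_densD_mul_const] at h
  have hm := measurable_comp_quantize c (cellInfo P q c)
  rw [← variance_sub_const hm.aestronglyMeasurable a]
  exact (variance_le_expectation_sq (hm.sub_const a).aestronglyMeasurable).trans
    ((ENNReal.ofReal_le_ofReal_iff (by positivity)).1 h)

/-! ### The mismatch between the decoder and the quantized decoder -/

/-- This is `t ^ 2 ≤ sinh t ^ 2` at `t = log (a / b) / 2`, since `4 * sinh t ^ 2 = (a - b) ^ 2 / (a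
* b)`. -/
lemma sq_log_sub_log_le {a b : ℝ} (ha : 0 < a) (hb : 0 < b) :
    (Real.log a - Real.log b) ^ 2 ≤ (a - b) ^ 2 / (a * b) := by
  set t := (Real.log a - Real.log b) / 2 with ht
  have h1 : t ^ 2 ≤ Real.sinh t ^ 2 := by
    rw [sq_le_sq, Real.abs_sinh]
    exact Real.self_le_sinh_iff.2 (abs_nonneg t)
  have h2 : Real.cosh (2 * t) = (a / b + (a / b)⁻¹) / 2 := by
    rw [← Real.cosh_log (by positivity), Real.log_div ha.ne' hb.ne', ht]
    congr 1; ring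
  have h3 := Real.cosh_two_mul t
  have h4 := Real.cosh_sq t
  calc (Real.log a - Real.log b) ^ 2 = 4 * t ^ 2 := by rw [ht]; ring
    _ ≤ 4 * Real.sinh t ^ 2 := by gcongr
    _ = 2 * (Real.cosh (2 * t) - 1) := by rw [h3, h4]; ring
    _ = (a - b) ^ 2 / (a * b) := by rw [h2]; field_simp; ring

/-- The previous inequality is applied to `√p` and `√r`; halving the logarithms gives the factor
`4`. The weight `p` cancels the singularity at `p = 0`, leaving `√p / √r ≤ 1 / √s`. -/
lemma mul_sq_log_sub_log_le {p r s : ℝ} (hp : 0 ≤ p) (hp1 : p ≤ 1) (hs : 0 < s) (hr : s ≤ r) :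
    p * (-Real.log r - -Real.log p) ^ 2 ≤ 4 * (√s)⁻¹ * (√r - √p) ^ 2 := by
  have hr0 : 0 < r := hs.trans_le hr
  rcases hp.eq_or_lt with rfl | hp
  · rw [zero_mul]; positivity
  have ha : 0 < √p := Real.sqrt_pos.2 hp
  have hb : 0 < √r := Real.sqrt_pos.2 hr0
  have hs' : 0 < √s := Real.sqrt_pos.2 hs
  have h := sq_log_sub_log_le ha hb
  rw [Real.log_sqrt hp.le, Real.log_sqrt hr0.le] at h
  have ha1 : √p ≤ 1 := Real.sqrt_le_one.2 hp1
  have hsb : √s ≤ √r := Real.sqrt_le_sqrt hr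
  calc p * (-Real.log r - -Real.log p) ^ 2
      = √p ^ 2 * (4 * (Real.log p / 2 - Real.log r / 2) ^ 2) := by rw [Real.sq_sqrt hp.le]; ring
    _ ≤ √p ^ 2 * (4 * ((√p - √r) ^ 2 / (√p * √r))) := by gcongr
    _ = 4 * (√p * (√r)⁻¹) * (√r - √p) ^ 2 := by field_simp; ring
    _ ≤ 4 * (1 * (√s)⁻¹) * (√r - √p) ^ 2 := by gcongr
    _ = _ := by ring

variable {Q : Decoder U Y}

lemma lintegral_densD_mul_hellinger {a : ℝ} (ha : 0 ≤ a) :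
    ∫⁻ u, ENNReal.ofReal (densD P q c u)
        * ENNReal.ofReal (a * ∑ y, (√(Q.prob u y) - √(decoderD P q c u y)) ^ 2) ∂vol
      = ENNReal.ofReal (2 * a * hellinger P q Q c ^ 2) := by
  set G : U → ℝ := fun u => ∑ y, (√(Q.prob u y) - √(decoderD P q c u y)) ^ 2 with hG
  have hGm : Measurable G := Finset.measurable_fun_sum _ fun y _ =>
    ((Q.measurable_prob y).sqrt.sub (measurable_decoderD P q c y).sqrt).pow_const 2
  have hG0 : ∀ u, 0 ≤ G u := fun u => Finset.sum_nonneg fun y _ => sq_nonneg _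
  have hGb : ∀ u, |G u| ≤ Fintype.card Y := by
    intro u
    rw [abs_of_nonneg (hG0 u)]
    refine (Finset.sum_le_sum (g := fun _ => (1 : ℝ)) fun y _ => ?_).trans (by simp)
    have h1 := Real.sqrt_le_one.2 (Q.prob_le_one u y)
    have h2 := Real.sqrt_le_one.2 (decoderD_le_one P q c u y)
    rw [sq_le_one_iff_abs_le_one, abs_le]
    constructor <;> linarith [Real.sqrt_nonneg (Q.prob u y), Real.sqrt_nonneg (decoderD P q c u y)]
  set ν := vol.withDensity fun u => ENNReal.ofReal (densD P q c u) with hν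
  have hdm : Measurable fun u => ENNReal.ofReal (densD P q c u) :=
    (measurable_densD P q c).ennreal_ofReal
  have hνp : IsProbabilityMeasure ν :=
    ⟨by rw [hν, withDensity_apply _ MeasurableSet.univ, Measure.restrict_univ, lintegral_densD]⟩
  have hh : 2 * a * hellinger P q Q c ^ 2 = ∫ u, a * G u ∂ν := by
    rw [hellinger, Real.sq_sqrt (mul_nonneg (by norm_num) (integral_nonneg hG0)),
      integral_const_mul]
    ring
  rw [hh, ofReal_integral_eq_lintegral_ofReal ((integrable_of_abs_le hGm hGb).const_mul a)
    (ae_of_all _ fun u => mul_nonneg ha (hG0 u)), hν,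
    lintegral_withDensity_eq_lintegral_mul _ hdm (hGm.const_mul a).ennreal_ofReal]
  rfl

/-- The loss at the centroid of a cell in excess of the information content of its label. -/
noncomputable def cellExcess (Q : Decoder U Y) (a : Fin K × Y) : ℝ :=
  loss q Q (c.center a.1 a.2) a.2 - cellInfo P q c a

/-- Jensen moves the square inside the average over `U`, where the pointwise comparison applies. The
constant is `8 = 4 * 2`, the `2` undoing the `1 / 2` in the Hellinger distance. -/
lemma integral_cellExcess_sq_le (hQ : 0 < Q.minProb) :
    ∫ z, cellExcess P q c Q (c.quantize z) ^ 2 ∂P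
      ≤ 8 * (√Q.minProb)⁻¹ * hellinger P q Q c ^ 2 := by
  have h := ofReal_integral_quantize_le P q c (g := fun x => x ^ 2)
    (even_two.convexOn_pow (𝕜 := ℝ)) (by fun_prop) (fun x => sq_nonneg _)
    (φ := fun u y => -Real.log (Q.prob u y) - -Real.log (decoderD P q c u y))
    (fun y => (Q.measurable_neg_log y).sub (measurable_neg_log_decoderD P q c y))
    (F := cellExcess P q c Q)
    (fun k y hw => by
      have h1 := Decoder.integrable_neg_log hQ q (c.center k y) y
      have h2 := integrable_neg_log_decoderD P q c hw
      refine ⟨h1.sub h2, ?_⟩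
      rw [integral_sub h1 h2, cellExcess, cellInfo_eq P q c hw]
      rfl)
    (B := fun u => 4 * (√Q.minProb)⁻¹ * ∑ y, (√(Q.prob u y) - √(decoderD P q c u y)) ^ 2)
    fun u _ => by
      rw [Finset.mul_sum]
      exact Finset.sum_le_sum fun y _ => mul_sq_log_sub_log_le (decoderD_nonneg P q c u y)
        (decoderD_le_one P q c u y) hQ (Q.minProb_le u y)
  rw [lintegral_densD_mul_hellinger P q c (by positivity)] at h
  have := (ENNReal.ofReal_le_ofReal_iff (by positivity)).1 h
  linarith

/-! ### The error gap -/

/-- The quantization error is paid twice, in the empirical mean and in the expectation. -/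
lemma gap_le [SFinite vol] (hQ : 0 < Q.minProb) {n : ℕ} (hn : 0 < n) (S : Fin n → X × Y) :
    gap P q Q S ≤ 2 * epsilonK q Q c
      + |1 / (n : ℝ) * ∑ i, cellInfo P q c (c.quantize (S i))
          - ∫ z, cellInfo P q c (c.quantize z) ∂P|
      + |1 / (n : ℝ) * ∑ i, cellExcess P q c Q (c.quantize (S i))
          - ∫ z, cellExcess P q c Q (c.quantize z) ∂P| := by
  have hn' : (0 : ℝ) < n := by exact_mod_cast hn
  have hint : ∀ F : Fin K × Y → ℝ, Integrable (fun z => F (c.quantize z)) P := fun F =>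
    have ⟨_, hb⟩ := exists_abs_comp_quantize_le c F
    integrable_of_abs_le (measurable_comp_quantize c F) hb
  have hli : Integrable (fun z : X × Y => loss q Q z.1 z.2) P :=
    integrable_of_abs_le (measurable_loss q Q) fun z => abs_loss_le q hQ z.1 z.2
  set d : X × Y → ℝ := fun z => loss q Q z.1 z.2
    - (cellInfo P q c (c.quantize z) + cellExcess P q c Q (c.quantize z)) with hd
  have hdi : Integrable d P := hli.sub ((hint _).add (hint _))
  have hde : ∀ z, |d z| ≤ epsilonK q Q c := by
    intro z
    have := abs_loss_sub_loss_center_le c q hQ z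
    simpa [hd, cellExcess, Quantization.quantize] using this
  have hloss : ∀ z : X × Y, loss q Q z.1 z.2
      = cellInfo P q c (c.quantize z) + cellExcess P q c Q (c.quantize z) + d z := by
    intro z; simp [hd]
  have hrisk : risk P q Q = ∫ z, cellInfo P q c (c.quantize z) ∂P
      + ∫ z, cellExcess P q c Q (c.quantize z) ∂P + ∫ z, d z ∂P := by
    simp only [risk, hloss]
    have hi : Integrable (fun z => cellInfo P q c (c.quantize z)
        + cellExcess P q c Q (c.quantize z)) P := (hint _).add (hint _)
    rw [integral_add hi hdi, integral_add (hint _) (hint _)]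
  have hemp : empRisk q Q S = 1 / (n : ℝ) * ∑ i, cellInfo P q c (c.quantize (S i))
      + 1 / (n : ℝ) * ∑ i, cellExcess P q c Q (c.quantize (S i))
      + 1 / (n : ℝ) * ∑ i, d (S i) := by
    simp only [empRisk, hloss, Finset.sum_add_distrib, mul_add]
  have h1 : |∫ z, d z ∂P| ≤ epsilonK q Q c := by
    simpa using norm_integral_le_of_norm_le_const (μ := P) (f := d) (ae_of_all _ hde)
  have h2 : |1 / (n : ℝ) * ∑ i, d (S i)| ≤ epsilonK q Q c := by
    rw [abs_mul, abs_of_pos (by positivity), one_div, inv_mul_le_iff₀ hn']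
    refine (Finset.abs_sum_le_sum_abs _ _).trans ?_
    refine (Finset.sum_le_sum fun i _ => hde (S i)).trans ?_
    simp
  rw [gap, hrisk, hemp]
  set A := 1 / (n : ℝ) * ∑ i, cellInfo P q c (c.quantize (S i))
  set B := 1 / (n : ℝ) * ∑ i, cellExcess P q c Q (c.quantize (S i))
  set D := 1 / (n : ℝ) * ∑ i, d (S i)
  set a := ∫ z, cellInfo P q c (c.quantize z) ∂P
  set b := ∫ z, cellExcess P q c Q (c.quantize z) ∂P
  set e := ∫ z, d z ∂P
  calc |A + B + D - (a + b + e)| = |(A - a) + (B - b) + (D - e)| := by congr 1; ring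
    _ ≤ |A - a| + |B - b| + |D - e| := abs_add_three _ _ _
    _ ≤ |A - a| + |B - b| + (|D| + |e|) := by gcongr; exact abs_sub _ _
    _ ≤ _ := by linarith

/-! ### The constants -/

lemma card_mul_minClassProb_le : (Fintype.card Y : ℝ) * minClassProb P ≤ 1 := by
  have := Measure.isProbabilityMeasure_map (μ := P) (f := Prod.snd) measurable_snd.aemeasurable
  have hsum : ∑ y, (P.map Prod.snd).real {y} = 1 := by
    rw [sum_measureReal_singleton]; simp
  rw [← hsum, ← nsmul_eq_mul, ← Finset.card_univ, ← Finset.sum_const]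
  refine Finset.sum_le_sum fun y _ => ciInf_le ⟨0, ?_⟩ y
  rintro _ ⟨y, rfl⟩
  exact measureReal_nonneg

lemma log_card_add_four_div_pos {m : ℕ} {δ : ℝ} (hδ : δ ∈ Set.Ioo (0 : ℝ) 1) :
    0 < Real.log (((m : ℝ) + 4) / δ) := by
  refine Real.log_pos ?_
  rw [one_lt_div hδ.1]
  have : (0 : ℝ) ≤ m := by positivity
  linarith [hδ.2]

/-- Here `v / p ≥ m`, so the logarithmic term of `constC` covers the deviation of `cellInfo`. The
term `2 * v * e⁻¹` makes `constC` positive even for `m = 1`, and the remainder divides by it. -/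
lemma le_constC {m : ℕ} (hm : 0 < m) {δ v p : ℝ} (hv : 1 ≤ v)
    (hp : 0 < p) (hmp : m * p ≤ 1) :
    0 < constC m δ v p ∧
      √(Real.log (((m : ℝ) + 4) / δ)) * √(m : ℝ) * Real.log m ≤ constC m δ v p := by
  have hm' : (1 : ℝ) ≤ m := by exact_mod_cast hm
  have h0 : 0 ≤ Real.log m := Real.log_nonneg hm'
  have h1 : Real.log m ≤ Real.log (v / p) := by
    refine Real.log_le_log (by linarith) ?_
    rw [le_div_iff₀ hp]
    linarith
  have hB : √(Real.log (((m : ℝ) + 4) / δ)) ≤ constB m δ := by rw [constB]; linarith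
  have hB0 : 0 ≤ constB m δ := (Real.sqrt_nonneg _).trans hB
  have hle : √(Real.log (((m : ℝ) + 4) / δ)) * √(m : ℝ) * Real.log m
      ≤ constB m δ * √(m : ℝ) * Real.log (v / p) := by gcongr
  have hpos : 0 < 2 * v * Real.exp (-1) := by positivity
  have hnn : 0 ≤ √(Real.log (((m : ℝ) + 4) / δ)) * √(m : ℝ) * Real.log m := by positivity
  rw [constC]
  constructor <;> linarith

lemma sqrt_div_eq_constD_mul {m : ℕ} {δ s h : ℝ} (hs : 0 < s) (hh : 0 ≤ h) :
    √(8 * (√s)⁻¹ * h ^ 2 / (δ / ((m : ℝ) + 4))) = constD m δ s * h := by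
  have h1 : (s ^ (-(1 / 4 : ℝ))) ^ 2 = (√s)⁻¹ := by
    rw [← Real.rpow_natCast, ← Real.rpow_mul hs.le, Real.sqrt_eq_rpow, ← Real.rpow_neg hs.le]
    norm_num
  have h2 : 0 ≤ s ^ (-(1 / 4 : ℝ)) := Real.rpow_nonneg hs.le _
  have h3 : 8 * (√s)⁻¹ * h ^ 2 / (δ / ((m : ℝ) + 4))
      = (s ^ (-(1 / 4 : ℝ)) * h) ^ 2 * (8 * (((m : ℝ) + 4) / δ)) := by
    rw [mul_pow, h1, div_div_eq_mul_div]; ring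
  rw [h3, Real.sqrt_mul (sq_nonneg _), Real.sqrt_sq (by positivity), constD]
  ring

/-! ### The bound -/

/-- The coefficient of `1 / n` in the remainder. -/
noncomputable def remainderConst (m : ℕ) (δ v p : ℝ) : ℝ :=
  4 * Real.log (((m : ℝ) + 4) / δ)
    + 4 * Real.log (((m : ℝ) + 4) / δ) ^ 2 * (48 * (m : ℝ) ^ 2) / constC m δ v p ^ 2

lemma pi_mainBound_add_lt_gap_le [Nonempty Y] [SFinite vol] (hP : 0 < minClassProb P)
    (hvol : 1 ≤ vol.real Set.univ) {δ : ℝ} (hδ : δ ∈ Set.Ioo (0 : ℝ) 1) (hQ : 0 < Q.minProb)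
    {n : ℕ} (hn : 0 < n) :
    Measure.pi (fun _ : Fin n => P)
        {S | mainBound P q Q δ n c
            + ENNReal.ofReal (remainderConst (Fintype.card Y) δ (vol.real Set.univ)
              (minClassProb P) / n) < ENNReal.ofReal (gap P q Q S)}
      ≤ ENNReal.ofReal δ := by
  set m := Fintype.card Y with hm
  have hm0 : 0 < m := Fintype.card_pos
  set L := Real.log (((m : ℝ) + 4) / δ) with hL
  have hL0 : 0 < L := log_card_add_four_div_pos hδ
  obtain ⟨hC0, hCle⟩ := le_constC hm0 (δ := δ) hvol hP (card_mul_minClassProb_le P)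
  set C := constC m δ (vol.real Set.univ) (minClassProb P) with hC
  set ρ := δ / ((m : ℝ) + 4) with hρ
  have hδ0 := hδ.1
  have hρ0 : 0 < ρ := by positivity
  have hexp : Real.exp (-L) = ρ := by
    rw [hL, Real.exp_neg, Real.exp_log (by positivity), inv_div]
  have hV : Var[fun z => cellInfo P q c (c.quantize z); P] ≤ C ^ 2 / (2 * L) := by
    refine (variance_cellInfo_le P q c).trans ?_
    rw [le_div_iff₀ (by positivity)]
    have h1 : (√L * √(m : ℝ) * Real.log m) ^ 2 ≤ C ^ 2 :=
      pow_le_pow_left₀ (by positivity) hCle 2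
    rw [mul_pow, mul_pow, Real.sq_sqrt hL0.le, Real.sq_sqrt (by positivity)] at h1
    linarith
  obtain ⟨b₁, hb₁⟩ := exists_abs_comp_quantize_le c (cellInfo P q c)
  obtain ⟨b₂, hb₂⟩ := exists_abs_comp_quantize_le c (cellExcess P q c Q)
  have hbern := pi_abs_mean_sub_gt_le (measurable_comp_quantize c (cellInfo P q c)) hb₁
    (fun z => cellInfo_nonneg P q c _) hC0 hL0 (integral_exp_cellInfo_le P q c) hV hn
  have hcheb := pi_abs_mean_sub_gt_le_of_second_moment
    (measurable_comp_quantize c (cellExcess P q c Q)) hb₂ (integral_cellExcess_sq_le P q c hQ)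
    hρ0 hn
  have hH0 : 0 ≤ hellinger P q Q c := Real.sqrt_nonneg _
  rw [sqrt_div_eq_constD_mul hQ hH0] at hcheb
  rw [hexp] at hbern
  set R := remainderConst m δ (vol.real Set.univ) (minClassProb P) with hR
  have hR0 : 0 ≤ R := by rw [hR, remainderConst]; positivity
  refine (measure_mono (t := _ ∪ _) ?_).trans ((measure_union_le _ _).trans
    ((add_le_add hbern hcheb).trans ?_))
  · intro S hS
    by_contra hcon
    simp only [Set.mem_union, Set.mem_ofPred_eq, not_or, not_lt] at hcon hS
    obtain ⟨h1, h2⟩ := hcon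
    refine absurd hS (not_lt.2 ?_)
    have hgap : gap P q Q S ≤ 2 * epsilonK q Q c
        + (constD m δ Q.minProb * hellinger P q Q c + C) / √n + R / n := by
      refine (gap_le P q c hQ hn S).trans ?_
      rw [add_div]
      have h1' : _ ≤ C / √n + R / n := h1
      linarith
    refine (ENNReal.ofReal_le_ofReal hgap).trans ?_
    refine ENNReal.ofReal_add_le.trans (add_le_add (ENNReal.ofReal_add_le.trans ?_) le_rfl)
    rw [mainBound]
    gcongr
    -- The mutual information term is discarded, being nonnegative.
    exact le_self_add
  -- Two Bernstein tails and one Chebyshev tail: `3 * ρ ≤ (m + 4) * ρ = δ`.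
  · rw [two_mul, ← ENNReal.ofReal_add hρ0.le hρ0.le, ← ENNReal.ofReal_add (by positivity) hρ0.le]
    refine ENNReal.ofReal_le_ofReal ?_
    have : ρ * ((m : ℝ) + 4) = δ := by rw [hρ]; field_simp
    nlinarith

/-- The thresholds `b i` do not depend on `ω`, so the events form a chain and continuity from below
replaces a union bound. -/
lemma measure_iInf_lt_le {Ω ι : Type*} [MeasurableSpace Ω] [Countable ι] (ν : Measure Ω)
    (f : Ω → ℝ≥0∞) (b : ι → ℝ≥0∞) {ε : ℝ≥0∞} (h : ∀ i, ν {ω | b i < f ω} ≤ ε) :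
    ν {ω | ⨅ i, b i < f ω} ≤ ε := by
  have hset : {ω | ⨅ i, b i < f ω} = ⋃ i, {ω | b i < f ω} := by
    ext ω; simp [iInf_lt_iff]
  have hdir : Directed (· ⊆ ·) fun i => {ω | b i < f ω} := by
    intro i j
    have hmono : ∀ {i j}, b i ≤ b j → {ω | b j < f ω} ⊆ {ω | b i < f ω} := by
      intro i j hij ω hω
      simp only [Set.mem_ofPred_eq] at hω ⊢
      exact hij.trans_lt hω
    rcases le_total (b i) (b j) with hij | hij
    · exact ⟨i, subset_rfl, hmono hij⟩
    · exact ⟨j, hmono hij, subset_rfl⟩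
  rw [hset, hdir.measure_iUnion]
  exact iSup_le h

end Bound

end CrossEntropyGap

/-! ### The remainder sequence and the infimum over quantizations -/

theorem theorem1 {X Y U : Type*} [MeasurableSpace X] [MeasurableSpace Y] [Fintype Y]
    [MeasurableSingletonClass Y] [MeasurableSpace U]
    (P : Measure (X × Y)) [IsProbabilityMeasure P] (hP : 0 < CrossEntropyGap.minClassProb P)
    (vol : Measure U) [IsFiniteMeasure vol] (hvol : 1 ≤ vol Set.univ)
    (δ : ℝ) (hδ : δ ∈ Set.Ioo (0 : ℝ) 1) :
    ∃ R : ℕ → ℝ≥0,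
      (fun n => (R n : ℝ)) =O[atTop] (fun n : ℕ => Real.log n / n) ∧
      ∀ (q : CrossEntropyGap.Encoder X vol) (Q : CrossEntropyGap.Decoder U Y)
        (η : ℝ), 0 < η → η ≤ Q.minProb →
      ∀ (N : Set ℕ) (quant : ∀ K : N, CrossEntropyGap.Quantization X Y (K : ℕ)),
      ∀ n : ℕ, 0 < n →
        ENNReal.ofReal (1 - δ) ≤
          Measure.pi (fun _ : Fin n => P)
            {S | ENNReal.ofReal (CrossEntropyGap.gap P q Q S) ≤
              (⨅ K : N, CrossEntropyGap.mainBound P q Q δ n (quant K)) + (R n : ℝ≥0∞)} := by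
  have hY : Nonempty Y := by
    obtain ⟨z⟩ := P.nonempty_of_neZero
    exact ⟨z.2⟩
  have hvol' : 1 ≤ vol.real Set.univ := by
    rw [measureReal_def, ← ENNReal.toReal_one]
    exact ENNReal.toReal_mono (measure_ne_top _ _) hvol
  set M := CrossEntropyGap.remainderConst (Fintype.card Y) δ (vol.real Set.univ)
    (CrossEntropyGap.minClassProb P)
  -- The remainder is in fact `O(1 / n)`, and `M` involves only `|𝒴|`, `δ`, the volume and the
  -- smallest class probability.
  refine ⟨fun n => (M / n).toNNReal, ?_, ?_⟩
  · refine IsBigO.of_bound |M| ?_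
    filter_upwards [eventually_ge_atTop 3] with n hn
    have hn' : (3 : ℝ) ≤ n := by exact_mod_cast hn
    have hlog : 1 ≤ Real.log n := by
      rw [Real.le_log_iff_exp_le (by linarith)]
      linarith [Real.exp_one_lt_d9]
    rw [Real.norm_of_nonneg (NNReal.coe_nonneg _), Real.coe_toNNReal', Real.norm_of_nonneg
      (by positivity)]
    refine max_le ?_ (by positivity)
    rw [← mul_div_assoc]
    gcongr
    exact (le_abs_self M).trans (le_mul_of_one_le_right (abs_nonneg M) hlog)
  · intro q Q η hη hηQ N quant n hn
    set ν := Measure.pi (fun _ : Fin n => P)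
    have hbad := CrossEntropyGap.measure_iInf_lt_le ν
      (fun S => ENNReal.ofReal (CrossEntropyGap.gap P q Q S))
      (fun K : N => CrossEntropyGap.mainBound P q Q δ n (quant K) + ENNReal.ofReal (M / n))
      fun K => CrossEntropyGap.pi_mainBound_add_lt_gap_le P q (quant K) hP hvol' hδ
        (hη.trans_le hηQ) hn
    rw [← ENNReal.iInf_add] at hbad
    set good := {S : Fin n → X × Y | ENNReal.ofReal (CrossEntropyGap.gap P q Q S) ≤
      (⨅ K : N, CrossEntropyGap.mainBound P q Q δ n (quant K)) + ((M / n).toNNReal : ℝ≥0∞)}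
      with hgood
    have hcompl : goodᶜ = {S | (⨅ K : N, CrossEntropyGap.mainBound P q Q δ n (quant K))
        + ENNReal.ofReal (M / n) < ENNReal.ofReal (CrossEntropyGap.gap P q Q S)} := by
      ext S
      simp [hgood, ENNReal.ofReal]
    rw [← hcompl] at hbad
    -- Subadditivity suffices here, so measurability of `good` is not needed.
    have hone : 1 ≤ ν good + ν goodᶜ := by
      rw [← measure_univ (μ := ν), ← Set.union_compl_self good]
      exact measure_union_le _ _
    rw [ENNReal.ofReal_sub _ hδ.1.le, ENNReal.ofReal_one, tsub_le_iff_right]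
    exact hone.trans (by gcongr)
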